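/- Let $k\ge 0$ and, for $1\le i\le k$, let $T_i$ be a homogeneous tree (a connected graph without cycles) in which every vertex has exactly $d_i\ge 3$ neighbours, and let $\omega_i$ be an end of $T_i$, i.e. a class of geodesic rays, two rays being equivalent if they have infinitely many common vertices. Give $\operatorname{Aut}(T_i)$ the topology of pointwise convergence on vertices, let $\operatorname{Aff}(T_i)\le\operatorname{Aut}(T_i)$ be the subgroup of automorphisms that fix $\omega_i$, with the subspace topology, and let $P=\prod_{i=1}^k\operatorname{Aff}(T_i)$ with the product topology. For a totally disconnected, locally compact group $G$ with modular function $\Delta_G$, the scale of $g\in G$ is $$s_G(g)=\min\{[gUg^{-1}:U\cap gUg^{-1}] : U \text{ a compact open subgroup of } G\}.$$ A subset $E\subseteq G$ is called unimodular in $G$ if $\Delta_G=1$ on $E$, and uniscalar in $G$ if $s_G=1$ on $E$; the group $G$ is called unimodular, respectively uniscalar, if $E=G$ is so in $G$. For an integer $a\ge1$, an element $\sigma\in\operatorname{Aff}(T_i)$ is called a translation by $a$ away from $\omega_i$ if there is a doubly infinite path $(\ell_m)_{m\in\mathbb Z}$ without backtracking in $T_i$ such that the ray $(\ell_0,\ell_{-1},\ell_{-2},\dots)$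 represents $\omega_i$ and $\sigma(\ell_m)=\ell_{m+a}$ for all $m\in\mathbb Z$. Then closed subgroups of $P$ can be unimodular but not uniscalar. Precisely: 1. If $k\ge2$, there is a closed subgroup $\Gamma$ of $P$ which, as a topological group in its own right, is unimodular but not uniscalar. 2. For every $i$ and every integer $a\ge1$ there is a translation by $a$ away from $\omega_i$ in $\operatorname{Aff}(T_i)$. If $i\ne j$ and $a,b\ge1$ are integers with $(d_i-1)^a=(d_j-1)^b$ (for example $d_i=d_j$ and $a=b=1$), if $\sigma$ and $\tau$ are translations by $a$ away from $\omega_i$ and by $b$ away from $\omega_j$, and if $\gamma\in P$ has $i$-th coordinate $\sigma$, $j$-th coordinate $\tau^{-1}$ and all other coordinates trivial, then the cyclic group $\Gamma=\langle\gamma\rangle$ is a closed subgroup of $P$ that is unimodular in $P$ but not uniscalar in $P$. -/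

import Mathlib

open scoped Pointwise

/-! ### Rays, ends and automorphisms of a tree -/

namespace SimpleGraph

variable {V : Type*}

/-- A geodesic ray: a singly infinite sequence of successive neighbours without backtracking. -/
structure GeodesicRay (T : SimpleGraph V) where
  /-- the `n`-th vertex of the ray -/
  vert : ℕ → V
  adj : ∀ n, T.Adj (vert n) (vert (n + 1))
  noBacktrack : ∀ n, vert n ≠ vert (n + 2)

/-- Automorphisms act on geodesic rays vertex by vertex. -/
instance (T : SimpleGraph V) : MulAction (T ≃g T) (GeodesicRay T) where
  smul g r :=
    { vert := fun n => g (r.vert n)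
      adj := fun n => g.map_rel_iff.2 (r.adj n)
      noBacktrack := fun n h => r.noBacktrack n (g.injective h) }
  one_smul _ := rfl
  mul_smul _ _ _ := rfl

/-- Two geodesic rays are equivalent if they have infinitely many vertices in common. -/
def GeodesicRay.IsEquivTo {T : SimpleGraph V} (r s : GeodesicRay T) : Prop :=
  (Set.range r.vert ∩ Set.range s.vert).Infinite

/-- An end of a tree: an equivalence class of geodesic rays. -/
structure TreeEnd (T : SimpleGraph V) where
  /-- the rays that represent the end -/
  rays : Set (GeodesicRay T)
  isClass : ∃ r : GeodesicRay T, rays = {s | r.IsEquivTo s}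

/-- The topology of pointwise convergence on the automorphism group of a graph
(the set of vertices being discrete). -/
instance (T : SimpleGraph V) : TopologicalSpace (T ≃g T) :=
  TopologicalSpace.induced (fun g v => g v) (@Pi.topologicalSpace V (fun _ => V) (fun _ => ⊥))

/-- The affine group of a tree `T` with distinguished end `ω`: the group of all automorphisms of
`T` that fix `ω`. It carries the subspace topology. -/
def Aff (T : SimpleGraph V) (ω : TreeEnd T) : Subgroup (T ≃g T) :=
  MulAction.stabilizer (T ≃g T) ω.rays

/-- `σ` is a translation by `n` steps, away from `ω`, along some doubly infinite path
`… ℓ (-1), ℓ 0, ℓ 1, …` without backtracking, whose negative half represents the end `ω`. -/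
def IsTranslationAwayFrom {T : SimpleGraph V} (ω : TreeEnd T) (n : ℕ) (σ : T ≃g T) : Prop :=
  ∃ ℓ : ℤ → V, (∀ m, T.Adj (ℓ m) (ℓ (m + 1))) ∧ (∀ m, ℓ m ≠ ℓ (m + 2)) ∧
    (∃ r ∈ ω.rays, ∀ m : ℕ, r.vert m = ℓ (-(m : ℤ))) ∧
    ∀ m, σ (ℓ m) = ℓ (m + n)

end SimpleGraph

/-! ### Scale and modular function -/

/-- The scale of an automorphism `α` of a totally disconnected, locally compact group `G`: the
minimum of the indices `[α(U) : U ∩ α(U)]` over the compact open subgroups `U` of `G`. -/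
noncomputable def autScale {G : Type*} [Group G] [TopologicalSpace G] (α : MulAut G) : ℕ :=
  sInf {n : ℕ | ∃ U : Subgroup G, IsCompact (U : Set G) ∧ IsOpen (U : Set G) ∧
    n = (U ⊓ U.map α.toMonoidHom).relIndex (U.map α.toMonoidHom)}

/-- The scale of a group element `g`: the scale of the conjugation `x ↦ g x g⁻¹`. -/
noncomputable def groupScale {G : Type*} [Group G] [TopologicalSpace G] (g : G) : ℕ :=
  autScale (MulAut.conj g)

/-- A set `E` of elements of `G` is uniscalar if the scale function of `G` is `1` on `E`. -/
def IsUniscalarOn {G : Type*} [Group G] [TopologicalSpace G] (E : Set G) : Prop :=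
  ∀ g ∈ E, groupScale g = 1

/-- The modular function of the locally compact group `G` is `1` on the set `E`: right translation
by each element of `E` preserves (left) Haar measure. For `E = G`: the group `G` is unimodular. -/
def IsUnimodularOn {G : Type*} [Group G] [TopologicalSpace G] (E : Set G) : Prop :=
  ∃ μ : @MeasureTheory.Measure G (borel G), @MeasureTheory.Measure.IsHaarMeasure G _ _ (borel G) μ ∧
    ∀ g ∈ E, @MeasureTheory.Measure.map G G (borel G) (borel G) (fun x => x * g) μ = μ

/-- The definition agrees with the one through Mathlib's modular character. -/
theorem isUnimodularOn_iff {G : Type*} [Group G] [TopologicalSpace G] [IsTopologicalGroup G]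
    [LocallyCompactSpace G] (E : Set G) :
    IsUnimodularOn E ↔ ∀ g ∈ E, MeasureTheory.Measure.modularCharacter g = 1 := by
  borelize G
  constructor
  · rintro ⟨μ, hμ, h⟩ g hg
    change MeasureTheory.Measure.modularCharacterFun g = 1
    rw [MeasureTheory.Measure.modularCharacterFun_eq_haarScalarFactor μ g]
    have key : ∀ (ν : MeasureTheory.Measure G) [ν.IsHaarMeasure], ν = μ →
        MeasureTheory.Measure.haarScalarFactor ν μ = 1 := by
      rintro ν _ rfl
      exact MeasureTheory.Measure.haarScalarFactor_self ν
    exact key _ (h g hg)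
  · intro h
    refine ⟨MeasureTheory.Measure.haar, inferInstance, fun g hg => ?_⟩
    have h1 : MeasureTheory.Measure.modularCharacterFun g = 1 := h g hg
    rw [MeasureTheory.Measure.modularCharacterFun_eq_haarScalarFactor
      (MeasureTheory.Measure.haar : MeasureTheory.Measure G) g] at h1
    have hreg : (MeasureTheory.Measure.map (fun x => x * g)
        (MeasureTheory.Measure.haar : MeasureTheory.Measure G)).Regular :=
      MeasureTheory.Measure.Regular.map (Homeomorph.mulRight g)
    have h2 := MeasureTheory.Measure.isMulLeftInvariant_eq_smul_of_regular
      (MeasureTheory.Measure.map (fun x => x * g)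
        (MeasureTheory.Measure.haar : MeasureTheory.Measure G)) MeasureTheory.Measure.haar
    rw [h1, one_smul] at h2
    exact h2

/-! Seen from its end, a tree is a genealogy: each vertex has one parent (the next vertex towards
the end), a level (Busemann function, dropping by one at the parent) and, once the siblings are
numbered, a label in `Fin (q + 2)`, where the degree is `q + 3`. A line of vertices labelled `0`,
the spine, comes out of the end. The affine group consists of the permutations that commute with the
parent map, and each of its elements changes all levels by the same amount, its shift. Any
level-dependent permutation of the labels that fixes `0` on all levels near the end, combined with
any shift, is realised by an affine element (`exists_relabel`). This supplies every automorphism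
that is needed.

Modular function: let `t` move the spine of tree `i` away from its end, that of tree `j` towards its
end, and fix all other spines. Let `U` be the stabiliser of all vertices `spine 0`. An element
fixing a spine vertex fixes all its ancestors, so `U ∩ t U t⁻¹` is cut out of `U` by one more vertex
of tree `i`, and out of `t U t⁻¹` by one more vertex of tree `j`. By orbit counting both have the
same Haar measure if the two orbits have the same size, and then the modular function is `1` at `t`.
In the full product the orbits have `(q i + 2) ^ a` and `(q j + 2) ^ b` elements.

Scale: if it were `1` at `t`, a compact open subgroup `U` would satisfy `t U t⁻¹ ≤ U`. Compactness
makes all elements of `U` of shift `0` in tree `j` fix one common spine vertex there. Conjugating by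
powers of `t`, which pull that spine towards the end, each such element would fix the whole spine.
But there are arbitrarily small elements that do not (`groupScale_ne_one`, `exists_flip`).

A cyclic group of this kind is discrete, hence uniscalar in itself. For a group with the required
properties of its own, the small flips are added: all pairs of opposite shift that on each level
either keep the labels or exchange `0` and `1`. Both orbits then have two elements whatever the
degrees are, and the elements of shift `0` are involutions or trivial, so the modular function is
`1` on them. -/

namespace SimpleGraph

/-! ### Busemann function and parent map of an end -/

variable {V : Type*} {T : SimpleGraph V}

/-- Geodesics from `w` and `w'` to `u`, each prolonged by `v`, are paths from `v` to `u`, and a tree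
has only one. -/
lemma IsTree.eq_of_adj_of_dist_add_one (hT : T.IsTree) {u v w w' : V} (hw : T.Adj v w)
    (hw' : T.Adj v w') (h : T.dist w u + 1 = T.dist v u) (h' : T.dist w' u + 1 = T.dist v u) :
    w = w' := by
  obtain ⟨p, hp⟩ := hT.connected.exists_walk_length_eq_dist w u
  obtain ⟨p', hp'⟩ := hT.connected.exists_walk_length_eq_dist w' u
  have h1 : (Walk.cons hw p).IsPath :=
    Walk.isPath_of_length_eq_dist _ (by rw [Walk.length_cons, hp, h])
  have h2 : (Walk.cons hw' p').IsPath :=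
    Walk.isPath_of_length_eq_dist _ (by rw [Walk.length_cons, hp', h'])
  have h3 := (hT.existsUnique_path v u).unique h1 h2
  have h4 := congrArg Walk.snd h3
  simpa using h4

lemma Connected.exists_adj_dist_add_one (hT : T.Connected) {u v : V} (h : v ≠ u) :
    ∃ w, T.Adj v w ∧ T.dist w u + 1 = T.dist v u := by
  obtain ⟨p, hp⟩ := hT.exists_walk_length_eq_dist v u
  cases p with
  | nil => exact absurd rfl h
  | cons hw q =>
    rename_i w
    refine ⟨w, hw, ?_⟩
    rw [Walk.length_cons] at hp
    have h1 := dist_le q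
    have h2 : T.dist v u ≤ T.dist v w + T.dist w u := hT.dist_triangle
    rw [dist_eq_one_iff_adj.2 hw] at h2
    omega

/-- Along a geodesic ray, the distance from a fixed vertex eventually grows by one at each step. -/
lemma IsTree.exists_dist_ray_eq (hT : T.IsTree) (r : GeodesicRay T) (v : V) :
    ∃ (b : ℤ) (N : ℕ), ∀ n, N ≤ n → (T.dist v (r.vert n) : ℤ) = b + n := by
  -- Once the ray recedes from `v` it recedes forever: the only neighbour nearer to `v` is the
  -- vertex just left, and backtracking is excluded.
  have step : ∀ n, T.dist v (r.vert (n + 1)) = T.dist v (r.vert n) + 1 →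
      T.dist v (r.vert (n + 2)) = T.dist v (r.vert (n + 1)) + 1 := by
    intro n hn
    rcases hT.dist_eq_dist_add_one_of_adj v (r.adj (n + 1)) with h | h
    · exfalso
      refine r.noBacktrack n (hT.eq_of_adj_of_dist_add_one (u := v) (r.adj n).symm
        (r.adj (n + 1)) ?_ ?_)
      · rw [dist_comm, dist_comm (v := v), hn]
      · rw [dist_comm, dist_comm (v := v)]; exact h.symm
    · exact h
  have ex : ∃ N, T.dist v (r.vert (N + 1)) = T.dist v (r.vert N) + 1 := by
    by_contra! hcon
    have h1 : ∀ n, T.dist v (r.vert n) + n = T.dist v (r.vert 0) := by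
      intro n
      induction n with
      | zero => rfl
      | succ n ih =>
        rcases hT.dist_eq_dist_add_one_of_adj v (r.adj n) with h | h
        · omega
        · exact absurd h (hcon n)
    have := h1 (T.dist v (r.vert 0) + 1)
    omega
  obtain ⟨N, hN⟩ := ex
  have h2 : ∀ k, T.dist v (r.vert (N + k + 1)) = T.dist v (r.vert (N + k)) + 1 := by
    intro k
    induction k with
    | zero => exact hN
    | succ k ih => exact step _ ih
  refine ⟨T.dist v (r.vert N) - N, N, fun n hn => ?_⟩
  obtain ⟨k, rfl⟩ := Nat.exists_eq_add_of_le hn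
  induction k with
  | zero => simp
  | succ k ih =>
    have := ih (by omega)
    have h3 := h2 k
    rw [← add_assoc, h3]
    push_cast at this ⊢
    omega

/-- A tree seen from an end: every vertex has a parent, the next vertex on the way to the end,
and a level, which drops by one towards the end. -/
structure EndCoord (T : SimpleGraph V) (ω : TreeEnd T) where
  /-- the next vertex on the way to the end -/
  parent : V → V
  /-- the Busemann function of the end -/
  level : V → ℤ
  level_parent : ∀ v, level (parent v) = level v - 1
  adj_iff : ∀ v w, T.Adj v w ↔ parent v = w ∨ parent w = v
  confluent : ∀ x y, ∃ m n, parent^[m] x = parent^[n] y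
  mem_rays_iff : ∀ s : GeodesicRay T, s ∈ ω.rays ↔ ∀ n, s.vert (n + 1) = parent (s.vert n)

theorem IsTree.nonempty_endCoord (hT : T.IsTree) (ω : TreeEnd T) : Nonempty (EndCoord T ω) := by
  -- The level is `b v`, the eventual value of `dist v (r n) - n`; the parent of `v` is its unique
  -- neighbour with a smaller `b`.
  obtain ⟨r, hr⟩ := ω.isClass
  choose b N hb using hT.exists_dist_ray_eq r
  have hadj : ∀ v w, T.Adj v w → b w = b v - 1 ∨ b v = b w - 1 := by
    intro v w hvw
    have h1 := hb v (max (N v) (N w)) (le_max_left _ _)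
    have h2 := hb w (max (N v) (N w)) (le_max_right _ _)
    have h3 := hT.dist_eq_dist_add_one_of_adj (r.vert (max (N v) (N w))) hvw
    rw [dist_comm (v := v), dist_comm (v := w)] at h3
    omega
  have huniq : ∀ v w w', T.Adj v w → T.Adj v w' → b w = b v - 1 → b w' = b v - 1 → w = w' := by
    intro v w w' hw hw' h h'
    set n := max (N v) (max (N w) (N w'))
    have h1 := hb v n (by omega)
    have h2 := hb w n (by omega)
    have h3 := hb w' n (by omega)
    exact hT.eq_of_adj_of_dist_add_one (u := r.vert n) hw hw' (by omega) (by omega)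
  have hex : ∀ v, ∃ w, T.Adj v w ∧ b w = b v - 1 := by
    intro v
    -- So far out that `dist v (r n) = b v + n` is positive; the first step of a geodesic from `v`
    -- to `r n` is then the parent.
    set n := N v + (b v).natAbs + 1 with hn
    have h1 := hb v n (by omega)
    have hne : v ≠ r.vert n := by
      intro h
      rw [← h, dist_self] at h1
      omega
    obtain ⟨w, hw, hd⟩ := hT.connected.exists_adj_dist_add_one hne
    refine ⟨w, hw, ?_⟩
    have h5 : ∀ k, T.dist w (r.vert (n + k)) ≤ T.dist w (r.vert n) + k := by
      intro k
      induction k with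
      | zero => simp
      | succ k ih =>
        have := hT.connected.dist_triangle (u := w) (v := r.vert (n + k)) (w := r.vert (n + k + 1))
        rw [dist_eq_one_iff_adj.2 (r.adj (n + k))] at this
        rw [← add_assoc]
        omega
    have h6 := h5 (N w)
    have h7 := hb w (n + N w) (by omega)
    have h8 := hb v (n + N w) (by omega)
    have h9 := hT.connected.dist_triangle (u := v) (v := w) (w := r.vert (n + N w))
    rw [dist_eq_one_iff_adj.2 hw] at h9
    push_cast at h7 h8
    omega
  choose p hpadj hpb using hex
  have hpadj' : ∀ v w, T.Adj v w ↔ p v = w ∨ p w = v := by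
    intro v w
    constructor
    · intro h
      rcases hadj v w h with h1 | h1
      · exact Or.inl (huniq v _ _ (hpadj v) h (hpb v) h1)
      · exact Or.inr (huniq w _ _ (hpadj w) h.symm (hpb w) h1)
    · rintro (rfl | rfl)
      · exact hpadj v
      · exact (hpadj w).symm
  have hconf : ∀ x y, ∃ m n, p^[m] x = p^[n] y := by
    intro x y
    obtain ⟨q⟩ := hT.connected.preconnected x y
    induction q with
    | nil => exact ⟨0, 0, rfl⟩
    | cons h q ih =>
      obtain ⟨m, n, hmn⟩ := ih
      rcases (hpadj' _ _).1 h with h1 | h1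
      · exact ⟨m + 1, n, by rw [Function.iterate_succ_apply, h1, hmn]⟩
      · exact ⟨m, n + 1, by rw [← h1, ← Function.iterate_succ_apply, Function.iterate_succ_apply',
          hmn, Function.iterate_succ_apply']⟩
  -- A ray that steps once to a child can only descend from then on, as the step to the parent would
  -- backtrack. Since `b ≤ 0` along `r`, it meets `r` in finitely many vertices only.
  have hup : ∀ (s : GeodesicRay T) n, s.vert (n + 1) ≠ p (s.vert n) → ∀ k,
      b (s.vert (n + k)) = b (s.vert n) + k ∧ p (s.vert (n + k + 1)) = s.vert (n + k) := by
    intro s n hn k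
    induction k with
    | zero =>
      refine ⟨by simp, ?_⟩
      rcases (hpadj' _ _).1 (s.adj n) with h | h
      · exact absurd h.symm hn
      · exact h
    | succ k ih =>
      have h1 := hpb (s.vert (n + k + 1))
      rw [ih.2] at h1
      refine ⟨?_, ?_⟩
      · rw [← add_assoc]; push_cast; omega
      · rcases (hpadj' _ _).1 (s.adj (n + k + 1)) with h | h
        · rw [ih.2] at h
          exact absurd h (s.noBacktrack (n + k))
        · exact h
  have hrb : ∀ n, b (r.vert n) ≤ 0 := by
    intro n
    have h1 := hb (r.vert n) (n + N (r.vert n)) (by omega)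
    have h5 : ∀ k, T.dist (r.vert n) (r.vert (n + k)) ≤ k := by
      intro k
      induction k with
      | zero => simp
      | succ k ih =>
        have := hT.connected.dist_triangle (u := r.vert n) (v := r.vert (n + k))
          (w := r.vert (n + k + 1))
        rw [dist_eq_one_iff_adj.2 (r.adj (n + k))] at this
        rw [← add_assoc]
        omega
    have := h5 (N (r.vert n))
    push_cast at h1
    omega
  have hmem : ∀ s : GeodesicRay T, r.IsEquivTo s → ∀ n, s.vert (n + 1) = p (s.vert n) := by
    intro s hs n
    by_contra hn
    apply hs
    refine Set.Finite.subset (Set.finite_range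
      (fun i : Fin (n + (b (s.vert n)).natAbs + 1) => s.vert i)) ?_
    rintro x ⟨⟨i, rfl⟩, ⟨j, hj⟩⟩
    rw [← hj]
    by_cases hjn : j < n + (b (s.vert n)).natAbs + 1
    · exact ⟨⟨j, hjn⟩, rfl⟩
    · exfalso
      obtain ⟨k, rfl⟩ := Nat.exists_eq_add_of_le (show n ≤ j by omega)
      have h1 := (hup s n hn k).1
      have h2 := hrb i
      rw [← hj] at h2
      omega
  have hiter : ∀ s : GeodesicRay T, (∀ n, s.vert (n + 1) = p (s.vert n)) → ∀ m n,
      s.vert (n + m) = p^[m] (s.vert n) := by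
    intro s hs m n
    induction m with
    | zero => rfl
    | succ m ih => rw [← add_assoc, hs, ih, Function.iterate_succ_apply']
  have hpinj : ∀ k l x, p^[k] x = p^[l] x → k = l := by
    have : ∀ k x, b (p^[k] x) = b x - k := by
      intro k x
      induction k with
      | zero => simp
      | succ k ih => rw [Function.iterate_succ_apply', hpb, ih]; push_cast; ring
    intro k l x h
    have h1 := this k x
    have h2 := this l x
    rw [h] at h1
    omega
  have hrr : r.IsEquivTo r := by
    unfold GeodesicRay.IsEquivTo
    rw [Set.inter_self]
    -- a ray takes infinitely many values
    intro hfin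
    have h1 : ∀ n, T.dist (r.vert 0) (r.vert n) = n := by
      have h2 : ∀ n, T.dist (r.vert 0) (r.vert n) = n ∧
          T.dist (r.vert 0) (r.vert (n + 1)) = n + 1 := by
        intro n
        induction n with
        | zero => exact ⟨by simp, dist_eq_one_iff_adj.2 (r.adj 0)⟩
        | succ n ih =>
          refine ⟨ih.2, ?_⟩
          rcases hT.dist_eq_dist_add_one_of_adj (r.vert 0) (r.adj (n + 1)) with h | h
          · exfalso
            refine r.noBacktrack n (hT.eq_of_adj_of_dist_add_one (u := r.vert 0) (r.adj n).symm
              (r.adj (n + 1)) ?_ ?_)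
            · rw [dist_comm, dist_comm (v := r.vert 0), ih.1, ih.2]
            · rw [dist_comm, dist_comm (v := r.vert 0)]; exact h.symm
          · rw [h, ih.2]
      exact fun n => (h2 n).1
    refine Set.infinite_range_of_injective (f := r.vert) (fun m n hmn => ?_) hfin
    rw [← h1 m, ← h1 n, hmn]
  have hrp := hmem r hrr
  refine ⟨⟨p, b, hpb, hpadj', hconf, fun s => ?_⟩⟩
  rw [hr]
  refine ⟨hmem s, fun hs => ?_⟩
  obtain ⟨m, n, hmn⟩ := hconf (r.vert 0) (s.vert 0)
  refine Set.infinite_of_injective_forall_mem (f := fun k : ℕ => p^[k] (r.vert m)) ?_ ?_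
  · intro k l h
    exact hpinj k l _ h
  · intro k
    refine ⟨⟨m + k, hiter r hrp k m⟩, ⟨n + k, ?_⟩⟩
    have h1 := hiter r hrp m 0
    have h2 := hiter s hs n 0
    rw [zero_add] at h1 h2
    rw [hiter s hs k n, h1, h2, hmn]

end SimpleGraph

/-! ### Affine group and horospherical coordinates -/

namespace SimpleGraph

variable {V : Type*} {T : SimpleGraph V} {ω : TreeEnd T}

namespace EndCoord

variable (E : EndCoord T ω)

lemma level_iterate (k : ℕ) (v : V) : E.level (E.parent^[k] v) = E.level v - k := by
  induction k with
  | zero => simp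
  | succ k ih => rw [Function.iterate_succ_apply', E.level_parent, ih]; push_cast; ring

lemma exists_iterate_eq_of_level_eq {x y : V} (h : E.level x = E.level y) :
    ∃ k, E.parent^[k] x = E.parent^[k] y := by
  obtain ⟨m, n, hmn⟩ := E.confluent x y
  have h1 := E.level_iterate m x
  have h2 := E.level_iterate n y
  rw [hmn] at h1
  obtain rfl : m = n := by omega
  exact ⟨m, hmn⟩

/-- The ray from a vertex to the end. -/
def rayFrom (v : V) : GeodesicRay T where
  vert n := E.parent^[n] v
  adj _ := (E.adj_iff _ _).2 (Or.inl (Function.iterate_succ_apply' _ _ _).symm)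
  noBacktrack n h := by
    have h1 := E.level_iterate n v
    have h2 := E.level_iterate (n + 2) v
    rw [← h] at h2
    push_cast at h2
    omega

lemma rayFrom_mem (v : V) : E.rayFrom v ∈ ω.rays :=
  (E.mem_rays_iff _).2 fun _ => Function.iterate_succ_apply' _ _ _

lemma smul_parent (g : T.Aff ω) (v : V) : g • E.parent v = E.parent (g • v) := by
  have h1 : (g : T ≃g T) • E.rayFrom v ∈ ω.rays :=
    (MulAction.mem_stabilizer_set.1 g.2 _).2 (E.rayFrom_mem v)
  exact (E.mem_rays_iff _).1 h1 0

lemma smul_iterate (g : T.Aff ω) (k : ℕ) (v : V) :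
    g • E.parent^[k] v = E.parent^[k] (g • v) := by
  induction k with
  | zero => rfl
  | succ k ih => rw [Function.iterate_succ_apply', E.smul_parent, ih, Function.iterate_succ_apply']

/-- A permutation of the vertices that commutes with the parent map, as an element of the affine
group. -/
def affOfPerm (e : Equiv.Perm V) (he : ∀ v, e (E.parent v) = E.parent (e v)) : T.Aff ω :=
  ⟨{ toEquiv := e
     map_rel_iff' := by
      intro a b
      rw [E.adj_iff, E.adj_iff, ← he, ← he, e.apply_eq_iff_eq, e.apply_eq_iff_eq] }, by
    refine MulAction.mem_stabilizer_set.2 fun s => ?_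
    rw [E.mem_rays_iff, E.mem_rays_iff]
    refine forall_congr' fun n => ?_
    change e (s.vert (n + 1)) = E.parent (e (s.vert n)) ↔ _
    rw [← he, e.apply_eq_iff_eq]⟩

@[simp] lemma affOfPerm_smul (e : Equiv.Perm V) (he : ∀ v, e (E.parent v) = E.parent (e v))
    (v : V) : E.affOfPerm e he • v = e v := rfl

/-- The two vertices have a common ancestor, and `g` commutes with the parent map. This makes the
shift of an element well defined. -/
lemma level_smul_sub (g : T.Aff ω) (x y : V) :
    E.level (g • x) - E.level x = E.level (g • y) - E.level y := by
  obtain ⟨m, n, hmn⟩ := E.confluent x y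
  have h1 := E.level_iterate m x
  have h2 := E.level_iterate n y
  have h3 := E.level_iterate m (g • x)
  have h4 := E.level_iterate n (g • y)
  rw [← E.smul_iterate] at h3 h4
  rw [hmn] at h1 h3
  omega

lemma card_children [T.LocallyFinite] {q : ℕ} (hreg : T.IsRegularOfDegree (q + 1)) (v : V) :
    Nat.card {w // E.parent w = v} = q := by
  have h1 : T.neighborSet v = insert (E.parent v) {w | E.parent w = v} := by
    ext w
    rw [mem_neighborSet, E.adj_iff, Set.mem_insert_iff, Set.mem_ofPred_eq, eq_comm]
  have h2 : E.parent v ∉ {w | E.parent w = v} := by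
    intro h
    have h3 := E.level_parent (E.parent v)
    rw [Set.mem_ofPred_eq] at h
    rw [h, E.level_parent] at h3
    omega
  have h3 : (T.neighborSet v).ncard = q + 1 := by
    rw [← hreg v, Set.ncard_eq_toFinset_card', ← card_neighborSet_eq_degree, Set.toFinset_card]
  have h4 : {w | E.parent w = v}.Finite :=
    (Set.toFinite (T.neighborSet v)).subset (by rw [h1]; exact Set.subset_insert _ _)
  rw [h1, Set.ncard_insert_of_notMem h2 h4] at h3
  change Nat.card ({w | E.parent w = v} : Set V) = q
  rw [Nat.card_coe_set_eq]
  omega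

lemma exists_spine [T.LocallyFinite] {q : ℕ} (hreg : T.IsRegularOfDegree (q + 2)) (v : V) :
    ∃ ℓ : ℤ → V, ∀ m, E.parent (ℓ (m + 1)) = ℓ m := by
  have hc : ∀ v, ∃ w, E.parent w = v := by
    intro v
    have h := E.card_children hreg v
    have : Nonempty {w // E.parent w = v} := by
      by_contra hne
      rw [not_nonempty_iff] at hne
      rw [Nat.card_of_isEmpty] at h
      omega
    exact ⟨this.some.1, this.some.2⟩
  choose c hc using hc
  refine ⟨fun m => if 0 ≤ m then c^[m.toNat] v else E.parent^[(-m).toNat] v, fun m => ?_⟩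
  rcases le_or_gt 0 m with h | h
  · simp only [if_pos h, if_pos (show 0 ≤ m + 1 by omega)]
    rw [show (m + 1).toNat = m.toNat + 1 by omega, Function.iterate_succ_apply', hc]
  · simp only [if_neg h.not_ge]
    rcases eq_or_ne m (-1) with rfl | h1
    · simp
    · rw [if_neg (by omega), show (-m).toNat = (-(m + 1)).toNat + 1 by omega,
        Function.iterate_succ_apply']

end EndCoord

/-- Horospherical coordinates: the children of every vertex are labelled, and a doubly infinite
line starting at the end consists of vertices with label zero. -/
structure HoroCoord (T : SimpleGraph V) (ω : TreeEnd T) (q : ℕ) extends EndCoord T ω where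
  /-- the label of a vertex among the children of its parent -/
  label : V → Fin (q + 2)
  bijective_parent_label : Function.Bijective fun v => (parent v, label v)
  /-- the line with label zero -/
  spine : ℤ → V
  parent_spine : ∀ m, parent (spine (m + 1)) = spine m
  label_spine : ∀ m, label (spine m) = 0
  level_spine : ∀ m, level (spine m) = m

lemma EndCoord.level_of_parent_spine (E : EndCoord T ω) {ℓ : ℤ → V}
    (hℓ : ∀ m, E.parent (ℓ (m + 1)) = ℓ m) (m : ℤ) : E.level (ℓ m) = E.level (ℓ 0) + m := by
  induction m using Int.induction_on with
  | zero => simp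
  | succ m ih =>
    have h := E.level_parent (ℓ (m + 1))
    rw [hℓ] at h
    omega
  | pred m ih =>
    have h := E.level_parent (ℓ (-m - 1 + 1))
    rw [hℓ, sub_add_cancel] at h
    omega

theorem EndCoord.exists_horoCoord (E : EndCoord T ω) [T.LocallyFinite] {q : ℕ}
    (hreg : T.IsRegularOfDegree (q + 3)) {ℓ : ℤ → V} (hℓ : ∀ m, E.parent (ℓ (m + 1)) = ℓ m) :
    ∃ H : HoroCoord T ω q, H.spine = ℓ := by
  have hlev := E.level_of_parent_spine hℓ
  have he : ∀ v, ∃ e : {w // E.parent w = v} ≃ Fin (q + 2),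
      ∀ m (h : ℓ m = v), e ⟨ℓ (m + 1), by rw [hℓ, h]⟩ = 0 := by
    intro v
    have hcard := E.card_children (q := q + 2) hreg v
    have : Finite {w // E.parent w = v} := Nat.finite_of_card_ne_zero (by omega)
    let e := Finite.equivFinOfCardEq hcard
    by_cases hv : ∃ m, ℓ m = v
    -- The numbering is corrected by a transposition so that the child on the line gets label `0`.
    -- By the levels, the line passes through `v` only once.
    · obtain ⟨m, hm⟩ := hv
      refine ⟨e.trans (Equiv.swap (e ⟨ℓ (m + 1), by rw [hℓ, hm]⟩) 0), fun m' hm' => ?_⟩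
      obtain rfl : m' = m := by
        have h1 := hlev m
        have h2 := hlev m'
        rw [hm'] at h2
        rw [hm] at h1
        omega
      simp
    · exact ⟨e, fun m hm => absurd ⟨m, hm⟩ hv⟩
  choose e he using he
  have hlabel : ∀ w v (h : E.parent w = v), e (E.parent w) ⟨w, rfl⟩ = e v ⟨w, h⟩ := by
    rintro w _ rfl
    rfl
  refine ⟨{ E with
    level := fun v => E.level v - E.level (ℓ 0)
    level_parent := fun v => by rw [E.level_parent]; ring
    label := fun w => e (E.parent w) ⟨w, rfl⟩
    bijective_parent_label := ⟨?_, ?_⟩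
    spine := ℓ
    parent_spine := hℓ
    label_spine := fun m => ?_
    level_spine := fun m => by rw [hlev]; ring }, rfl⟩
  · intro w w' h
    obtain ⟨h1, h2⟩ := Prod.mk.inj h
    rw [hlabel w _ h1] at h2
    exact congrArg Subtype.val ((e _).injective h2)
  · rintro ⟨v, a⟩
    refine ⟨(e v).symm a, Prod.ext ((e v).symm a).2 ?_⟩
    change e (E.parent _) ⟨_, rfl⟩ = a
    rw [hlabel _ _ ((e v).symm a).2]
    simp
  · have h := hℓ (m - 1)
    rw [sub_add_cancel] at h
    rw [hlabel _ _ h]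
    have h2 := he _ (m - 1) rfl
    simp only [sub_add_cancel] at h2
    exact h2

namespace HoroCoord

variable {q : ℕ} (H : HoroCoord T ω q)

lemma iterate_spine (k : ℕ) (m : ℤ) : H.parent^[k] (H.spine m) = H.spine (m - k) := by
  induction k with
  | zero => simp
  | succ k ih =>
    rw [Function.iterate_succ_apply', ih, ← H.parent_spine (m - (k + 1 : ℕ))]
    congr 2
    push_cast
    ring

/-- Vertices of one level have a common ancestor of the same generation; from there the labels
determine the way down. -/
lemma eq_of_labels {x y : V} (hl : H.level x = H.level y)
    (h : ∀ k, H.label (H.parent^[k] x) = H.label (H.parent^[k] y)) : x = y := by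
  obtain ⟨k, hk⟩ := H.exists_iterate_eq_of_level_eq hl
  induction k with
  | zero => exact hk
  | succ k ih =>
    refine ih (H.bijective_parent_label.1 (Prod.ext ?_ (h k)))
    simpa only [Function.iterate_succ_apply'] using hk

/-- Every vertex has all its distant ancestors on the spine. -/
lemma exists_iterate_eq_spine (v : V) :
    ∃ K : ℕ, ∀ k, K ≤ k → H.parent^[k] v = H.spine (H.level v - k) := by
  obtain ⟨K, hK⟩ := H.exists_iterate_eq_of_level_eq (x := v) (y := H.spine (H.level v))
    (H.level_spine _).symm
  refine ⟨K, fun k hk => ?_⟩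
  obtain ⟨j, rfl⟩ := Nat.exists_eq_add_of_le hk
  rw [add_comm, Function.iterate_add_apply, hK, ← Function.iterate_add_apply, H.iterate_spine]

/-- The child with a given label. -/
noncomputable def child (v : V) (a : Fin (q + 2)) : V :=
  (Equiv.ofBijective _ H.bijective_parent_label).symm (v, a)

lemma parent_label_child (v : V) (a : Fin (q + 2)) :
    (H.parent (H.child v a), H.label (H.child v a)) = (v, a) :=
  (Equiv.ofBijective _ H.bijective_parent_label).apply_symm_apply (v, a)

@[simp] lemma parent_child (v : V) (a : Fin (q + 2)) : H.parent (H.child v a) = v :=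
  (Prod.mk.inj (H.parent_label_child v a)).1

@[simp] lemma label_child (v : V) (a : Fin (q + 2)) : H.label (H.child v a) = a :=
  (Prod.mk.inj (H.parent_label_child v a)).2

lemma eq_child {v w : V} {a : Fin (q + 2)} (h1 : H.parent w = v) (h2 : H.label w = a) :
    H.child v a = w :=
  H.bijective_parent_label.1 (by simp [h1, h2])

/-- Approximations to the map that relabels by `π` and shifts levels by `n`. -/
noncomputable def relabelAux (π : ℤ → Equiv.Perm (Fin (q + 2))) (n : ℤ) : ℕ → V → V
  | 0, v => H.spine (H.level v + n)
  | k + 1, v => H.child (relabelAux π n k (H.parent v)) (π (H.level v) (H.label v))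

lemma level_relabelAux (π : ℤ → Equiv.Perm (Fin (q + 2))) (n : ℤ) (k : ℕ) (v : V) :
    H.level (H.relabelAux π n k v) = H.level v + n := by
  induction k generalizing v with
  | zero => exact H.level_spine _
  | succ k ih =>
    have h1 := H.level_parent (H.relabelAux π n (k + 1) v)
    rw [relabelAux, parent_child, ih, H.level_parent] at h1
    rw [relabelAux]
    omega

/-- The `k`-th approximation sends the `k`-th ancestor to the spine. If that ancestor lies on the
spine at a level where `π` fixes `0`, starting one generation further back changes nothing, so the
approximations stabilise at each vertex. -/
lemma relabelAux_succ {π : ℤ → Equiv.Perm (Fin (q + 2))} {N : ℤ} (hπ : ∀ m ≤ N, π m 0 = 0)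
    (n : ℤ) (k : ℕ) (v : V) (h : H.parent^[k] v = H.spine (H.level v - k))
    (hN : H.level v - k ≤ N) : H.relabelAux π n (k + 1) v = H.relabelAux π n k v := by
  induction k generalizing v with
  | zero =>
    simp only [Nat.cast_zero, sub_zero, Function.iterate_zero, id_eq] at h hN
    have h0 : H.label v = 0 := by rw [h, H.label_spine]
    rw [relabelAux, relabelAux, relabelAux, h0, hπ _ hN]
    refine H.eq_child ?_ (H.label_spine _)
    rw [H.level_parent, ← H.parent_spine (H.level v - 1 + n)]
    congr 2
    ring
  | succ k ih =>
    rw [relabelAux, ih (H.parent v) ?_ ?_]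
    · rfl
    · rw [← Function.iterate_succ_apply, h, H.level_parent]
      congr 1
      push_cast
      ring
    · rw [H.level_parent]
      push_cast at hN
      omega

theorem exists_relabel_map {π : ℤ → Equiv.Perm (Fin (q + 2))} {N : ℤ} (hπ : ∀ m ≤ N, π m 0 = 0)
    (n : ℤ) : ∃ f : V → V, (∀ v, f (H.parent v) = H.parent (f v)) ∧
      (∀ v, H.level (f v) = H.level v + n) ∧
      ∀ v, H.label (f v) = π (H.level v) (H.label v) := by
  have hex : ∀ v, ∃ K : ℕ, ∀ k, K ≤ k → H.relabelAux π n k v = H.relabelAux π n K v := by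
    intro v
    obtain ⟨K, hK⟩ := H.exists_iterate_eq_spine v
    -- From here on the `k`-th ancestor is on the spine and its level is at most `N`.
    refine ⟨K + (H.level v - N).natAbs, fun k hk => ?_⟩
    induction k, hk using Nat.le_induction with
    | base => rfl
    | succ k hk ih =>
      rw [H.relabelAux_succ hπ n k v (hK k (by omega)) (by omega), ih]
  choose K hK using hex
  have hf : ∀ v, H.relabelAux π n (K v) v =
      H.child (H.relabelAux π n (K (H.parent v)) (H.parent v)) (π (H.level v) (H.label v)) := by
    intro v
    rw [← hK v (K v + K (H.parent v) + 1) (by omega), relabelAux,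
      hK (H.parent v) (K v + K (H.parent v)) (by omega)]
  refine ⟨fun v => H.relabelAux π n (K v) v, fun v => ?_, fun v => H.level_relabelAux π n _ v,
    fun v => ?_⟩
  · simp only
    rw [hf v, parent_child]
  · simp only
    rw [hf v, label_child]

lemma eq_id_of_label {f : V → V} (h1 : ∀ v, f (H.parent v) = H.parent (f v))
    (h2 : ∀ v, H.level (f v) = H.level v) (h3 : ∀ v, H.label (f v) = H.label v) (v : V) :
    f v = v := by
  have h4 : ∀ k, H.parent^[k] (f v) = f (H.parent^[k] v) := by
    intro k
    induction k with
    | zero => rfl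
    | succ k ih => rw [Function.iterate_succ_apply', ih, Function.iterate_succ_apply', h1]
  exact H.eq_of_labels (h2 v) fun k => by rw [h4, h3]

/-- Relabelling the children by permutations depending only on the level, combined with a shift of
the levels. -/
theorem exists_relabel {π : ℤ → Equiv.Perm (Fin (q + 2))} {N : ℤ} (hπ : ∀ m ≤ N, π m 0 = 0)
    (n : ℤ) : ∃ g : T.Aff ω, (∀ v, H.level (g • v) = H.level v + n) ∧
      ∀ v, H.label (g • v) = π (H.level v) (H.label v) := by
  obtain ⟨f, hf1, hf2, hf3⟩ := H.exists_relabel_map hπ n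
  -- The inverse relabelling reads `π` at the level before the shift.
  obtain ⟨f', hf1', hf2', hf3'⟩ := H.exists_relabel_map (π := fun m => (π (m - n))⁻¹) (N := N + n)
    (fun m hm => by rw [Equiv.Perm.inv_eq_iff_eq, hπ _ (by omega)]) (-n)
  refine ⟨H.affOfPerm ⟨f, f', fun v => ?_, fun v => ?_⟩ hf1, hf2, hf3⟩
  · refine H.eq_id_of_label (f := fun v => f' (f v)) ?_ ?_ ?_ v
    · intro v; simp only [hf1, hf1']
    · intro v; simp only [hf2, hf2']; ring
    · intro v; simp only [hf3, hf3', hf2]; simp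
  · refine H.eq_id_of_label (f := fun v => f (f' v)) ?_ ?_ ?_ v
    · intro v; simp only [hf1, hf1']
    · intro v; simp only [hf2, hf2']; ring
    · intro v; simp only [hf3, hf3', hf2']; simp [sub_eq_add_neg]

/-- The number of levels by which an element of the affine group moves away from the end. -/
def shift (g : T.Aff ω) : ℤ := H.level (g • H.spine 0)

lemma level_smul (g : T.Aff ω) (v : V) : H.level (g • v) = H.level v + H.shift g := by
  have h := H.level_smul_sub g v (H.spine 0)
  rw [H.level_spine] at h
  unfold shift
  omega

lemma shift_mul (g g' : T.Aff ω) : H.shift (g * g') = H.shift g + H.shift g' := by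
  rw [shift, mul_smul, level_smul, add_comm]
  rfl

lemma shift_one : H.shift (1 : T.Aff ω) = 0 := by
  rw [shift, one_smul, H.level_spine]

lemma shift_inv (g : T.Aff ω) : H.shift g⁻¹ = - H.shift g := by
  have h := H.shift_mul g⁻¹ g
  rw [inv_mul_cancel, shift_one] at h
  omega

lemma shift_eq_zero {g : T.Aff ω} {v : V} (h : g • v = v) : H.shift g = 0 := by
  have h1 := H.level_smul g v
  rw [h] at h1
  omega

lemma smul_spine_of_le {g : T.Aff ω} {m n k : ℤ} (h : g • H.spine m = H.spine n) (hk : k ≤ m) :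
    g • H.spine k = H.spine (k + (n - m)) := by
  obtain ⟨j, hj⟩ := Int.le.dest hk
  have h1 := H.smul_iterate g j (H.spine m)
  rw [h, H.iterate_spine, H.iterate_spine, show m - j = k by omega] at h1
  rw [h1]
  congr 1
  omega

lemma smul_spine {g : T.Aff ω} (h : ∀ v, H.label (g • v) = H.label v) (m : ℤ) :
    g • H.spine m = H.spine (m + H.shift g) := by
  refine H.eq_of_labels ?_ fun k => ?_
  · rw [H.level_smul, H.level_spine, H.level_spine]
  · rw [← H.smul_iterate, h, H.iterate_spine, H.iterate_spine, H.label_spine, H.label_spine]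

/-- The translation by `n` along the spine that preserves all labels. -/
theorem exists_translation (n : ℤ) : ∃ g : T.Aff ω, H.shift g = n ∧
    (∀ v, H.label (g • v) = H.label v) ∧ ∀ m, g • H.spine m = H.spine (m + n) := by
  obtain ⟨g, h1, h2⟩ := H.exists_relabel (π := 1) (N := 0) (by simp) n
  have h3 : H.shift g = n := by rw [shift, h1, H.level_spine, zero_add]
  refine ⟨g, h3, h2, fun m => ?_⟩
  rw [H.smul_spine h2, h3]

/-- The automorphism exchanging the labels `0` and `1` at level `M + 1`. -/
theorem exists_flip (M : ℤ) : ∃ g : T.Aff ω,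
    (∀ v, H.level v ≤ M → g • v = v) ∧ (∀ m, M < m → g • H.spine m ≠ H.spine m) ∧
    H.label (g • H.spine (M + 1)) = 1 ∧
    ∀ v, H.label (g • v) = (if H.level v = M + 1 then Equiv.swap 0 1 else 1 :
      Equiv.Perm (Fin (q + 2))) (H.label v) := by
  obtain ⟨g, h1, h2⟩ := H.exists_relabel
    (π := fun m => if m = M + 1 then Equiv.swap 0 1 else 1) (N := M)
    (fun m hm => by rw [if_neg (by omega)]; rfl) 0
  have h3 : H.label (g • H.spine (M + 1)) = 1 := by
    rw [h2, H.level_spine, if_pos rfl, H.label_spine, Equiv.swap_apply_left]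
  refine ⟨g, fun v hv => ?_, fun m hm h => ?_, h3, h2⟩
  · refine H.eq_of_labels (by rw [h1, add_zero]) fun k => ?_
    rw [← H.smul_iterate, h2, if_neg]
    · rfl
    · rw [H.level_iterate]; omega
  · have h4 := H.smul_spine_of_le h (k := M + 1) (by omega)
    rw [h4, H.label_spine] at h3
    exact zero_ne_one h3

/-- The stabiliser of a spine vertex is transitive on the descendants of each generation. -/
theorem exists_smul_spine_eq (m : ℤ) (a : ℕ) {w : V} (hw : H.parent^[a] w = H.spine m) :
    ∃ g : T.Aff ω, g • H.spine m = H.spine m ∧ g • H.spine (m + a) = w := by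
  obtain ⟨g, h1, h2⟩ := H.exists_relabel (N := m)
    -- At each level between `m` and `m + a`, label `0` is exchanged with the label of the ancestor
    -- of `w` there. Beyond `m + a`, `toNat` truncates to the label of `w` itself, which is
    -- harmless.
    (π := fun i => if i ≤ m then 1 else
      Equiv.swap 0 (H.label (H.parent^[(m + a - i).toNat] w)))
    (fun i hi => by rw [if_pos hi]; rfl) 0
  have hlw : H.level w = m + a := by
    have := H.level_iterate a w
    rw [hw, H.level_spine] at this
    omega
  have h3 : g • H.spine (m + a) = w := by
    refine H.eq_of_labels (by rw [h1, H.level_spine, hlw, add_zero]) fun k => ?_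
    rw [← H.smul_iterate, H.iterate_spine, h2, H.level_spine, H.label_spine]
    split_ifs with hk
    · obtain ⟨j, rfl⟩ := Nat.exists_eq_add_of_le (show a ≤ k by omega)
      rw [add_comm a j, Function.iterate_add_apply, hw, H.iterate_spine, H.label_spine]
      rfl
    · rw [Equiv.swap_apply_left]
      congr 3
      omega
  refine ⟨g, ?_, h3⟩
  have h4 := H.smul_iterate g a (H.spine (m + a))
  rw [h3, hw, H.iterate_spine, add_sub_cancel_right] at h4
  exact h4

lemma finite_descendants (v : V) (a : ℕ) : {w | H.parent^[a] w = v}.Finite := by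
  induction a generalizing v with
  | zero => simp
  | succ a ih =>
    have h1 : {w | H.parent^[a + 1] w = v} =
        ⋃ x : Fin (q + 2), {w | H.parent^[a] w = H.child v x} := by
      ext w
      simp only [Set.mem_ofPred_eq, Set.mem_iUnion, Function.iterate_succ_apply']
      constructor
      · intro h
        exact ⟨_, (H.eq_child h rfl).symm⟩
      · rintro ⟨x, hx⟩
        rw [hx, parent_child]
    rw [h1]
    exact Set.finite_iUnion fun x => ih _

lemma ncard_descendants (v : V) (a : ℕ) : {w | H.parent^[a] w = v}.ncard = (q + 2) ^ a := by
  induction a with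
  | zero => simp
  | succ a ih =>
    have h1 : {w | H.parent^[a + 1] w = v} =
        (fun x : V × Fin (q + 2) => H.child x.1 x.2) ''
          ({w | H.parent^[a] w = v} ×ˢ (Set.univ : Set (Fin (q + 2)))) := by
      ext w
      simp only [Set.mem_ofPred_eq, Set.mem_image, Set.mem_prod, Set.mem_univ, and_true,
        Function.iterate_succ_apply]
      constructor
      · intro h
        exact ⟨(H.parent w, H.label w), h, H.eq_child rfl rfl⟩
      · rintro ⟨x, hx, rfl⟩
        rw [parent_child, hx]
    rw [h1, Set.ncard_image_of_injective, Set.ncard_prod, ih, Set.ncard_univ, Nat.card_fin, pow_succ]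
    intro x y h
    simp only at h
    have h2 := H.parent_label_child x.1 x.2
    rw [h, H.parent_label_child] at h2
    exact h2.symm

end HoroCoord

/-- Coordinates along a translation axis. -/
theorem exists_horoCoord_of_line (hT : T.IsTree) [T.LocallyFinite] {q : ℕ}
    (hreg : T.IsRegularOfDegree (q + 3)) {ℓ : ℤ → V} (h1 : ∀ m, T.Adj (ℓ m) (ℓ (m + 1)))
    (h2 : ∀ m, ℓ m ≠ ℓ (m + 2)) (h3 : ∃ r ∈ ω.rays, ∀ m : ℕ, r.vert m = ℓ (-(m : ℤ))) :
    ∃ H : HoroCoord T ω q, H.spine = ℓ := by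
  obtain ⟨E⟩ := hT.nonempty_endCoord ω
  refine E.exists_horoCoord hreg fun m => ?_
  obtain ⟨r, hr, hrl⟩ := h3
  rw [E.mem_rays_iff] at hr
  have hneg : ∀ m : ℕ, E.parent (ℓ (-(m : ℤ))) = ℓ (-(m : ℤ) - 1) := by
    intro m
    have := hr m
    rw [hrl, hrl] at this
    rw [← this]
    congr 1
    push_cast
    ring
  have hpos : ∀ m : ℕ, E.parent (ℓ m) = ℓ (m - 1) := by
    intro m
    induction m with
    | zero => exact hneg 0
    | succ m ih =>
      -- The line comes from the end, so a step to the parent would backtrack; the positive half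
      -- therefore descends.
      rcases (E.adj_iff _ _).1 (h1 m) with h | h
      · rw [ih] at h
        have := h2 (m - 1)
        rw [h] at this
        exact absurd (by congr 1; ring) this
      · push_cast
        rw [h, add_sub_cancel_right]
  rcases le_or_gt 0 m with h | h
  · have := hpos (m.toNat + 1)
    rw [show ((m.toNat + 1 : ℕ) : ℤ) = m + 1 by omega, add_sub_cancel_right] at this
    exact this
  · have := hneg (-(m + 1)).toNat
    rw [show -(((-(m + 1)).toNat : ℕ) : ℤ) = m + 1 by omega, add_sub_cancel_right] at this
    exact this

theorem nonempty_horoCoord (hT : T.IsTree) [T.LocallyFinite] {q : ℕ}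
    (hreg : T.IsRegularOfDegree (q + 3)) (ω : TreeEnd T) : Nonempty (HoroCoord T ω q) := by
  obtain ⟨E⟩ := hT.nonempty_endCoord ω
  obtain ⟨v⟩ := hT.connected.nonempty
  obtain ⟨ℓ, hℓ⟩ := E.exists_spine (q := q + 1) hreg v
  exact ⟨(E.exists_horoCoord hreg hℓ).choose⟩

theorem HoroCoord.isTranslationAwayFrom {q : ℕ} (H : HoroCoord T ω q) {g : T.Aff ω} {n : ℕ}
    (h : ∀ m, g • H.spine m = H.spine (m + n)) : IsTranslationAwayFrom ω n (g : T ≃g T) := by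
  refine ⟨H.spine, fun m => ?_, fun m hm => ?_, ⟨H.rayFrom (H.spine 0), H.rayFrom_mem _,
    fun m => ?_⟩, h⟩
  · exact (H.adj_iff _ _).2 (Or.inr (H.parent_spine m))
  · have h1 := H.level_spine m
    rw [hm, H.level_spine] at h1
    omega
  · have := H.iterate_spine m 0
    rw [zero_sub] at this
    exact this

end SimpleGraph

/-! ### Topology of the affine group -/

namespace SimpleGraph

variable {V : Type*} {T : SimpleGraph V} {ω : TreeEnd T}

lemma isLocallyConstant_iso_apply (v : V) : IsLocallyConstant fun g : T ≃g T => g v := by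
  let _ : TopologicalSpace V := ⊥
  have _ : DiscreteTopology V := ⟨rfl⟩
  have h : Continuous fun (g : T ≃g T) (w : V) => g w := continuous_induced_dom
  exact (IsLocallyConstant.iff_continuous _).2 ((continuous_apply v).comp h)

lemma continuous_iso_of_isLocallyConstant {X : Type*} [TopologicalSpace X] {F : X → (T ≃g T)}
    (h : ∀ v, IsLocallyConstant fun x => F x v) : Continuous F := by
  let _ : TopologicalSpace V := ⊥
  exact continuous_induced_rng.2 (continuous_pi fun v => (h v).continuous)

instance isTopologicalGroup_iso : IsTopologicalGroup (T ≃g T) where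
  continuous_mul := by
    refine continuous_iso_of_isLocallyConstant fun v => ?_
    rw [IsLocallyConstant.iff_eventually_eq]
    rintro ⟨g, h⟩
    have h1 := (isLocallyConstant_iso_apply (T := T) (h v)).eventually_eq g
    have h2 := (isLocallyConstant_iso_apply (T := T) v).eventually_eq h
    filter_upwards [h1.prod_nhds h2] with x hx
    change x.1 (x.2 v) = g (h v)
    rw [hx.2, hx.1]
  continuous_inv := by
    refine continuous_iso_of_isLocallyConstant fun v => ?_
    rw [IsLocallyConstant.iff_eventually_eq]
    intro g
    filter_upwards [(isLocallyConstant_iso_apply (T := T) (g⁻¹ v)).eventually_eq g] with x hx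
    rw [RelIso.apply_inv_self] at hx
    rw [← hx, RelIso.inv_apply_self, hx]

instance t2Space_iso : T2Space (T ≃g T) := by
  let _ : TopologicalSpace V := ⊥
  have _ : DiscreteTopology V := ⟨rfl⟩
  have h : Continuous fun (g : T ≃g T) (w : V) => g w := continuous_induced_dom
  exact T2Space.of_injective_continuous DFunLike.coe_injective h

lemma isLocallyConstant_smul (v : V) : IsLocallyConstant fun g : T.Aff ω => g • v :=
  (isLocallyConstant_iso_apply v).comp_continuous continuous_subtype_val

namespace HoroCoord

variable {q : ℕ}

/-- Fixing `v₀` means fixing its ancestors, among them a common ancestor of `v` and `v₀`, and that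
vertex has finitely many descendants in the generation of `v`. -/
lemma finite_orbit_stabilizer (H : HoroCoord T ω q) (v₀ v : V) : {w | ∃ g : T.Aff ω, g • v₀ = v₀ ∧ g • v = w}.Finite := by
  obtain ⟨m, n, hmn⟩ := H.confluent v v₀
  refine (H.finite_descendants (H.parent^[n] v₀) m).subset ?_
  rintro w ⟨g, hg, rfl⟩
  rw [Set.mem_ofPred_eq, ← H.smul_iterate, hmn, H.smul_iterate, hg]

theorem isCompact_stabilizer (H : HoroCoord T ω q) (v₀ : V) : IsCompact {g : T.Aff ω | g • v₀ = v₀} := by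
  let _ : TopologicalSpace V := ⊥
  have _ : DiscreteTopology V := ⟨rfl⟩
  -- Recording `g⁻¹` too makes bijectivity a closed condition. The image of the stabiliser is then
  -- closed in a product of finite orbits, as commuting with the parent map suffices for being
  -- affine.
  let f : T.Aff ω → (V → V) × (V → V) := fun g => (fun v => g • v, fun v => g⁻¹ • v)
  have hc : Continuous f := (continuous_pi fun v => (isLocallyConstant_smul v).continuous).prodMk
    (continuous_pi fun v => (isLocallyConstant_smul v).continuous.comp continuous_inv)
  have hi : Topology.IsInducing f := by
    refine Topology.IsInducing.of_comp hc continuous_fst ?_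
    have h1 : Topology.IsInducing fun (g : T ≃g T) (w : V) => g w := ⟨rfl⟩
    exact h1.comp Topology.IsInducing.subtypeVal
  rw [hi.isCompact_iff]
  let S : V → Set V := fun v => {w | ∃ g : T.Aff ω, g • v₀ = v₀ ∧ g • v = w}
  have hS : IsCompact (Set.pi Set.univ S ×ˢ Set.pi Set.univ S) :=
    (isCompact_univ_pi fun v => (H.finite_orbit_stabilizer v₀ v).isCompact).prod
      (isCompact_univ_pi fun v => (H.finite_orbit_stabilizer v₀ v).isCompact)
  have hev1 : ∀ (v : V) (s : Set V), IsClosed {x : (V → V) × (V → V) | x.1 v ∈ s} := fun v s =>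
    (isClosed_discrete s).preimage ((continuous_apply v).comp continuous_fst)
  have hev2 : ∀ (v : V) (s : Set V), IsClosed {x : (V → V) × (V → V) | x.2 v ∈ s} := fun v s =>
    (isClosed_discrete s).preimage ((continuous_apply v).comp continuous_snd)
  have himg : f '' {g | g • v₀ = v₀} = {x | x.1 v₀ ∈ ({v₀} : Set V)} ∩
      ((⋂ v, ⋂ w, {x | x.2 v ∈ ({w}ᶜ : Set V)} ∪ {x | x.1 w ∈ ({v} : Set V)}) ∩
      ((⋂ v, ⋂ w, {x | x.1 v ∈ ({w}ᶜ : Set V)} ∪ {x | x.2 w ∈ ({v} : Set V)}) ∩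
      ⋂ v, ⋂ w, {x | x.1 v ∈ ({w}ᶜ : Set V)} ∪
        {x | x.1 (H.parent v) ∈ ({H.parent w} : Set V)})) := by
    ext ⟨a, b⟩
    simp only [Set.mem_image, Set.mem_inter_iff, Set.mem_iInter, Set.mem_union,
      Set.mem_ofPred_eq, Set.mem_compl_iff, Set.mem_singleton_iff]
    constructor
    · rintro ⟨g, hg, hgf⟩
      obtain ⟨rfl, rfl⟩ := Prod.mk.inj hgf
      refine ⟨hg, fun v w => ?_, fun v w => ?_, fun v w => ?_⟩
      · rw [← imp_iff_not_or]
        rintro rfl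
        exact smul_inv_smul _ _
      · rw [← imp_iff_not_or]
        rintro rfl
        exact inv_smul_smul _ _
      · rw [← imp_iff_not_or]
        rintro rfl
        exact H.smul_parent _ _
    · rintro ⟨h0, h1, h2, h3⟩
      simp only [← imp_iff_not_or] at h1 h2 h3
      refine ⟨H.affOfPerm ⟨a, b, fun v => h2 _ _ rfl, fun v => h1 _ _ rfl⟩
        (fun v => h3 _ _ rfl), h0, rfl⟩
  refine hS.of_isClosed_subset ?_ ?_
  · rw [himg]
    refine (hev1 _ _).inter (IsClosed.inter ?_ (IsClosed.inter ?_ ?_))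
    · exact isClosed_iInter fun v => isClosed_iInter fun w => (hev2 _ _).union (hev1 _ _)
    · exact isClosed_iInter fun v => isClosed_iInter fun w => (hev1 _ _).union (hev2 _ _)
    · exact isClosed_iInter fun v => isClosed_iInter fun w => (hev1 _ _).union (hev1 _ _)
  · rintro _ ⟨g, hg, rfl⟩
    refine ⟨fun v _ => ⟨g, hg, rfl⟩, fun v _ => ⟨g⁻¹, ?_, rfl⟩⟩
    rw [inv_smul_eq_iff]
    exact hg.symm

theorem locallyCompactSpace_aff (H : HoroCoord T ω q) : LocallyCompactSpace (T.Aff ω) :=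
  (H.isCompact_stabilizer (H.spine 0)).locallyCompactSpace_of_mem_nhds_of_group (x := 1)
    (((isLocallyConstant_smul _).isOpen_fiber _).mem_nhds (one_smul _ _))

lemma isLocallyConstant_shift (H : HoroCoord T ω q) : IsLocallyConstant (H.shift : T.Aff ω → ℤ) :=
  (isLocallyConstant_smul _).comp H.level

end HoroCoord

end SimpleGraph

/-! ### Modular function and scale -/

section Modular

open MeasureTheory

variable {G : Type*} [Group G]

/-- Orbit-stabiliser with measures: `U` is the disjoint union of left translates of the stabiliser
of `x`, one for each point of the orbit `O`. -/
lemma measure_eq_ncard_orbit_mul [MeasurableSpace G] [MeasurableMul G] (μ : Measure G)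
    [μ.IsMulLeftInvariant] {A X : Type*} [Group A] [MulAction A X] (φ : G →* A) (U : Subgroup G)
    (x : X) (O : Set X) (hO : O.Finite) (hUO : ∀ g ∈ U, φ g • x ∈ O)
    (hOU : ∀ y ∈ O, ∃ g ∈ U, φ g • x = y)
    (hW : MeasurableSet {g | g ∈ U ∧ φ g • x = x}) :
    μ (U : Set G) = O.ncard * μ {g | g ∈ U ∧ φ g • x = x} := by
  choose! c hcU hcx using hOU
  have h1 : (U : Set G) = ⋃ y ∈ hO.toFinset, c y • {g | g ∈ U ∧ φ g • x = x} := by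
    ext g
    simp only [SetLike.mem_coe, Set.mem_iUnion, Set.Finite.mem_toFinset, Set.mem_smul_set_iff_inv_smul_mem,
      Set.mem_ofPred_eq, smul_eq_mul, map_mul, map_inv, mul_smul, exists_prop]
    constructor
    · intro hg
      refine ⟨_, hUO g hg, U.mul_mem (U.inv_mem (hcU _ (hUO g hg))) hg, ?_⟩
      rw [inv_smul_eq_iff, hcx _ (hUO g hg)]
    · rintro ⟨y, hy, h, -⟩
      simpa using U.mul_mem (hcU y hy) h
  rw [h1, measure_biUnion_finset]
  · simp only [measure_smul, Finset.sum_const, nsmul_eq_mul]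
    rw [Set.ncard_eq_toFinset_card _ hO]
  · intro y hy z hz hyz
    refine Set.disjoint_left.2 fun g h2 h3 => hyz ?_
    simp only [Set.mem_smul_set_iff_inv_smul_mem, Set.mem_ofPred_eq, smul_eq_mul, map_mul, map_inv,
      mul_smul, inv_smul_eq_iff] at h2 h3
    rw [hcx _ (by simpa using hy)] at h2
    rw [hcx _ (by simpa using hz)] at h3
    rw [← h2.2, h3.2]
  · intro y _
    exact hW.const_smul _

variable [TopologicalSpace G] [IsTopologicalGroup G] [LocallyCompactSpace G]

/-- If `U` is a compact open subgroup and the common intersection of `U` and `t U t⁻¹` is in both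
the stabiliser of a point with orbits of the same size, then the modular function is `1` at `t`. -/
theorem modularCharacter_eq_one_of_orbits {A B X Y : Type*} [Group A] [MulAction A X] [Group B]
    [MulAction B Y] (φ : G →* A) (ψ : G →* B) (U : Subgroup G) (hUc : IsCompact (U : Set G))
    (hUo : IsOpen (U : Set G)) (t : G) (x : X) (y : Y) (O : Set X) (O' : Set Y) (hO : O.Finite)
    (hO' : O'.Finite) (hcard : O.ncard = O'.ncard)
    (hUO : ∀ g ∈ U, φ g • x ∈ O) (hOU : ∀ z ∈ O, ∃ g ∈ U, φ g • x = z)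
    (hUO' : ∀ g, t⁻¹ * g * t ∈ U → ψ g • y ∈ O')
    (hOU' : ∀ z ∈ O', ∃ g, t⁻¹ * g * t ∈ U ∧ ψ g • y = z)
    (hW : ∀ g ∈ U, φ g • x = x ↔ t⁻¹ * g * t ∈ U)
    (hW' : ∀ g, t⁻¹ * g * t ∈ U → (ψ g • y = y ↔ g ∈ U)) :
    Measure.modularCharacter t = 1 := by
  borelize G
  let μ : Measure G := Measure.haar
  let U' : Subgroup G := U.comap (MulAut.conj t⁻¹).toMonoidHom
  have hU' : ∀ g, g ∈ U' ↔ t⁻¹ * g * t ∈ U := by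
    intro g
    simp [U', Subgroup.mem_comap]
  have hU'o : IsOpen (U' : Set G) := by
    have : (U' : Set G) = (fun g => t⁻¹ * g * t) ⁻¹' (U : Set G) := by
      ext g
      exact hU' g
    rw [this]
    exact hUo.preimage (by fun_prop)
  have e1 : {g | g ∈ U ∧ φ g • x = x} = (U : Set G) ∩ U' := by
    ext g
    constructor
    · rintro ⟨h1, h2⟩
      exact ⟨h1, (hU' g).2 ((hW g h1).1 h2)⟩
    · rintro ⟨h1, h2⟩
      exact ⟨h1, (hW g h1).2 ((hU' g).1 h2)⟩
  have e2 : {g | g ∈ U' ∧ ψ g • y = y} = (U : Set G) ∩ U' := by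
    ext g
    constructor
    · rintro ⟨h1, h2⟩
      exact ⟨(hW' g ((hU' g).1 h1)).1 h2, h1⟩
    · rintro ⟨h1, h2⟩
      exact ⟨h2, (hW' g ((hU' g).1 h2)).2 h1⟩
  have hm : MeasurableSet ((U : Set G) ∩ U') := (hUo.inter hU'o).measurableSet
  have m1 := measure_eq_ncard_orbit_mul μ φ U x O hO hUO hOU (by rw [e1]; exact hm)
  have m2 := measure_eq_ncard_orbit_mul μ ψ U' y O' hO' (fun g hg => hUO' g ((hU' g).1 hg))
    (fun z hz => by
      obtain ⟨g, hg, hgz⟩ := hOU' z hz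
      exact ⟨g, (hU' g).2 hg, hgz⟩) (by rw [e2]; exact hm)
  rw [e1] at m1
  rw [e2, ← hcard, ← m1] at m2
  -- The left side is the measure of `U t⁻¹`, by left invariance that of `U' = t U t⁻¹`, which
  -- equals that of `U`. As it is finite and nonzero, the scalar factor is `1`.
  have m3 : Measure.map (· * t) μ (U : Set G) = μ (U : Set G) := by
    rw [Measure.map_apply (measurable_mul_const t) hUo.measurableSet, ← m2,
      ← measure_preimage_mul μ t⁻¹]
    congr 1
    ext g
    simp [hU']
  change Measure.modularCharacterFun t = 1
  rw [Measure.modularCharacterFun_eq_haarScalarFactor μ t]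
  have m4 := Measure.measure_isMulInvariant_eq_smul_of_isCompact_closure (Measure.map (· * t) μ) μ
    (s := (U : Set G)) (hUc.closure)
  rw [m3] at m4
  have h0 : μ (U : Set G) ≠ 0 := (hUo.measure_pos μ ⟨1, U.one_mem⟩).ne'
  have htop : μ (U : Set G) ≠ ⊤ := hUc.measure_lt_top.ne
  rw [ENNReal.smul_def, smul_eq_mul] at m4
  have h5 := (ENNReal.mul_eq_right h0 htop).1 m4.symm
  exact_mod_cast h5

end Modular

/-! ### Scale of a translation towards the end -/

namespace SimpleGraph.HoroCoord

variable {V : Type*} {T : SimpleGraph V} {ω : TreeEnd T} {q : ℕ} (H : HoroCoord T ω q)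

open Filter Topology

/-- A group element acting on a tree as a translation towards the end has scale different from
`1`, provided that small elements of the group move the translation axis. -/
theorem groupScale_ne_one {G : Type*} [Group G] [TopologicalSpace G] (φ : G →* T.Aff ω)
    (hφ : Continuous φ) (t : G) (b : ℕ) (hb : 1 ≤ b)
    (ht : ∀ m, φ t • H.spine m = H.spine (m - b)) (u : ℕ → G) (hu : Tendsto u atTop (𝓝 1))
    (hu0 : ∀ M, φ (u M) • H.spine 0 = H.spine 0)
    (hum : ∀ (M : ℕ) (m : ℤ), M < m → φ (u M) • H.spine m ≠ H.spine m) : groupScale t ≠ 1 := by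
  intro h
  -- On `ℕ` the infimum of the empty set is `0`, so scale `1` yields a compact open subgroup that
  -- attains it.
  have hne : {n : ℕ | ∃ U : Subgroup G, IsCompact (U : Set G) ∧ IsOpen (U : Set G) ∧
      n = (U ⊓ U.map (MulAut.conj t).toMonoidHom).relIndex
        (U.map (MulAut.conj t).toMonoidHom)}.Nonempty := by
    rw [Set.nonempty_iff_ne_empty]
    intro he
    rw [groupScale, autScale, he, Nat.sInf_empty] at h
    exact zero_ne_one h
  obtain ⟨U, hUc, hUo, hU⟩ := Nat.sInf_mem hne
  change groupScale t = _ at hU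
  rw [h, eq_comm, Subgroup.relIndex_eq_one] at hU
  have hconj : ∀ g ∈ U, t * g * t⁻¹ ∈ U := fun g hg =>
    (hU (Subgroup.mem_map_of_mem (MulAut.conj t).toMonoidHom hg)).1
  have hconj' : ∀ n : ℕ, ∀ g ∈ U, t ^ n * g * (t ^ n)⁻¹ ∈ U := by
    intro n g hg
    induction n with
    | zero => simpa using hg
    | succ n ih =>
      have := hconj _ ih
      rwa [pow_succ', mul_inv_rev, show t * t ^ n * g * ((t ^ n)⁻¹ * t⁻¹) =
        t * (t ^ n * g * (t ^ n)⁻¹) * t⁻¹ by group]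
  let _ : TopologicalSpace V := ⊥
  have _ : DiscreteTopology V := ⟨rfl⟩
  have hfin : ((fun g => φ g • H.spine 0) '' (U : Set G)).Finite :=
    (hUc.image ((isLocallyConstant_smul _).continuous.comp hφ)).finite_of_discrete
  choose K hK using H.exists_iterate_eq_spine
  obtain ⟨B, hB⟩ := (hfin.image K).bddAbove
  -- The orbit of `spine 0` under the compact `U` is finite, so one `B` bounds how far all its
  -- points are from having their ancestors on the spine.
  have hfix : ∀ g ∈ U, H.shift (φ g) = 0 → φ g • H.spine (-B) = H.spine (-B) := by
    intro g hg h0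
    have h1 := hK (φ g • H.spine 0) B (hB ⟨_, ⟨g, hg, rfl⟩, rfl⟩)
    rw [← H.smul_iterate, H.iterate_spine, H.level_smul, h0, H.level_spine] at h1
    simpa using h1
  obtain ⟨M, hM⟩ := (hu.eventually (hUo.mem_nhds U.one_mem)).exists
  -- Chosen so that `t ^ n` carries a spine vertex beyond level `M`, moved by `u M`, to `spine
  -- (-B)`: its level `-B + b * n` is at least `M + 1`.
  set n := M + B + 1 with hn
  have htn : ∀ m, φ (t ^ n) • H.spine m = H.spine (m - b * n) := by
    generalize n = n
    intro m
    induction n with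
    | zero => simp
    | succ n ih =>
      rw [pow_succ', map_mul, mul_smul, ih, ht]
      congr 1
      push_cast
      ring
  have h2 := hfix _ (hconj' n _ hM) (by
    rw [map_mul, map_mul, H.shift_mul, H.shift_mul, map_inv, H.shift_inv,
      H.shift_eq_zero (hu0 M)]
    ring)
  rw [map_mul, map_mul, mul_smul, mul_smul, map_inv] at h2
  have h3 := htn (-B + b * n)
  rw [add_sub_cancel_right] at h3
  have h4 : (φ (t ^ n))⁻¹ • H.spine (-B) = H.spine (-B + b * n) := by
    rw [inv_smul_eq_iff, h3]
  rw [h4, ← h3, smul_left_cancel_iff] at h2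
  refine hum M _ ?_ h2
  have : (n : ℤ) ≤ b * n := by nlinarith
  omega

end SimpleGraph.HoroCoord

/-! ### Elements that permute labels level by level -/

namespace SimpleGraph

open Filter Topology MeasureTheory

section Aff

variable {V : Type*} {T : SimpleGraph V} {ω : TreeEnd T}

lemma aff_eq_one {g : T.Aff ω} (h : ∀ v : V, g • v = v) : g = 1 :=
  Subtype.ext (RelIso.ext h)

lemma tendsto_aff_one {u : ℕ → T.Aff ω} (h : ∀ v : V, ∀ᶠ n in atTop, u n • v = v) :
    Tendsto u atTop (𝓝 1) := by
  let _ : TopologicalSpace V := ⊥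
  have _ : DiscreteTopology V := ⟨rfl⟩
  have h1 : Topology.IsInducing fun (g : T ≃g T) (w : V) => g w := ⟨rfl⟩
  rw [(h1.comp Topology.IsInducing.subtypeVal).tendsto_nhds_iff, tendsto_pi_nhds]
  intro v
  refine tendsto_const_nhds.congr' ?_
  filter_upwards [h v] with n hn
  exact hn.symm

namespace HoroCoord

variable {q : ℕ} (H : HoroCoord T ω q)

lemma shift_zpow (g : T.Aff ω) (k : ℤ) : H.shift (g ^ k) = k * H.shift g := by
  let f : T.Aff ω →* Multiplicative ℤ :=
    { toFun := fun g => Multiplicative.ofAdd (H.shift g)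
      map_one' := by rw [H.shift_one]; rfl
      map_mul' := fun a b => by rw [H.shift_mul]; rfl }
  have h := congrArg Multiplicative.toAdd (map_zpow f g k)
  rw [toAdd_zpow, smul_eq_mul] at h
  exact h

lemma shift_eq_of_smul_spine {g : T.Aff ω} {n : ℤ}
    (h : ∀ m, g • H.spine m = H.spine (m + n)) : H.shift g = n := by
  rw [shift, h, H.level_spine, zero_add]

/-- The elements that, on each level, change the labels by a permutation in `K`. -/
def labelSubgroup (K : Subgroup (Equiv.Perm (Fin (q + 2)))) : Subgroup (T.Aff ω) where
  carrier := {g | ∀ m, ∃ κ ∈ K, ∀ v, H.level v = m → H.label (g • v) = κ (H.label v)}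
  one_mem' := fun _ => ⟨1, K.one_mem, fun v _ => by rw [one_smul]; rfl⟩
  mul_mem' := by
    intro g g' hg hg' m
    obtain ⟨κ', hκ', h'⟩ := hg' m
    obtain ⟨κ, hκ, h⟩ := hg (m + H.shift g')
    refine ⟨κ * κ', K.mul_mem hκ hκ', fun v hv => ?_⟩
    rw [mul_smul, h _ (by rw [H.level_smul, hv]), h' _ hv, Equiv.Perm.mul_apply]
  inv_mem' := by
    intro g hg m
    obtain ⟨κ, hκ, h⟩ := hg (m - H.shift g)
    refine ⟨κ⁻¹, K.inv_mem hκ, fun v hv => ?_⟩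
    have h1 := h (g⁻¹ • v) (by rw [H.level_smul, hv, H.shift_inv]; ring)
    rw [smul_inv_smul] at h1
    rw [h1]
    exact (κ.symm_apply_apply _).symm

lemma mem_labelSubgroup {K : Subgroup (Equiv.Perm (Fin (q + 2)))} {g : T.Aff ω} :
    g ∈ H.labelSubgroup K ↔
      ∀ m, ∃ κ ∈ K, ∀ v, H.level v = m → H.label (g • v) = κ (H.label v) := Iff.rfl

/-- For each level only finitely many permutations are available, so the existential quantifier is a
finite union of closed sets. -/
lemma isClosed_labelSubgroup (K : Subgroup (Equiv.Perm (Fin (q + 2)))) :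
    IsClosed (H.labelSubgroup K : Set (T.Aff ω)) := by
  have h : (H.labelSubgroup K : Set (T.Aff ω)) = ⋂ m : ℤ, ⋃ κ : K, ⋂ v : V, ⋂ _ : H.level v = m,
      {g | H.label (g • v) = κ.1 (H.label v)} := by
    ext g
    simp [mem_labelSubgroup]
  rw [h]
  refine isClosed_iInter fun m => isClosed_iUnion_of_finite fun κ => isClosed_iInter fun v =>
    isClosed_iInter fun _ => ?_
  exact ((isLocallyConstant_smul v).comp H.label).isClosed_fiber _

/-- Translations and elements exchanging the labels `0` and `1` on some levels. -/
def flipSubgroup : Subgroup (T.Aff ω) := H.labelSubgroup (Subgroup.zpowers (Equiv.swap 0 1))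

lemma eq_one_or_eq_swap {κ : Equiv.Perm (Fin (q + 2))}
    (h : κ ∈ Subgroup.zpowers (Equiv.swap (0 : Fin (q + 2)) 1)) : κ = 1 ∨ κ = Equiv.swap 0 1 := by
  obtain ⟨k, rfl⟩ := Subgroup.mem_zpowers_iff.1 h
  rcases Int.even_or_odd' k with ⟨c, rfl | rfl⟩
  · left
    rw [zpow_mul, zpow_ofNat, pow_two, Equiv.swap_mul_self, one_zpow]
  · right
    rw [zpow_add, zpow_mul, zpow_ofNat, pow_two, Equiv.swap_mul_self, one_zpow, one_mul, zpow_one]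

/-- With shift `0` the second application meets the same level, hence the same permutation, which is
trivial or a transposition. -/
lemma mul_self_of_mem_flipSubgroup {g : T.Aff ω} (hg : g ∈ H.flipSubgroup)
    (h : H.shift g = 0) : g * g = 1 := by
  have hs : ∀ v, H.level (g • v) = H.level v := fun v => by rw [H.level_smul, h, add_zero]
  refine aff_eq_one fun v => ?_
  rw [mul_smul]
  refine H.eq_id_of_label (f := fun v => g • g • v) (fun v => ?_) (fun v => ?_) (fun v => ?_) v
  · simp only [H.smul_parent]
  · simp only [hs]
  · obtain ⟨κ, hκ, h1⟩ := hg (H.level v)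
    rw [h1 _ (hs v), h1 v rfl]
    rcases eq_one_or_eq_swap hκ with rfl | rfl
    · rfl
    · rw [Equiv.swap_apply_self]

lemma mem_flipSubgroup_of_label {g : T.Aff ω} (h : ∀ v, H.label (g • v) = H.label v) :
    g ∈ H.flipSubgroup :=
  fun _ => ⟨1, Subgroup.one_mem _, fun v _ => h v⟩

lemma mem_flipSubgroup_of_flip {g : T.Aff ω} {M : ℤ}
    (h : ∀ v, H.label (g • v) = (if H.level v = M then Equiv.swap 0 1 else 1 :
      Equiv.Perm (Fin (q + 2))) (H.label v)) : g ∈ H.flipSubgroup := by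
  refine fun m => ⟨_, ?_, fun v hv => by rw [h v, hv]⟩
  split_ifs
  · exact Subgroup.mem_zpowers _
  · exact Subgroup.one_mem _

end HoroCoord

end Aff

/-! ### Opposite translations in a product of affine groups -/

section Product

variable {I : Type*} {V : I → Type*} {T : ∀ i, SimpleGraph (V i)}
  {ω : ∀ i, TreeEnd (T i)} {q : I → ℕ} (H : ∀ i, HoroCoord (T i) (ω i) (q i))

/-- A group acting on trees has modular function `1` at an element translating along the spines, in
the `i`-th tree away from the end and in the `j`-th towards the end, if both translations have the
same local index. -/
theorem modularCharacter_eq_one_of_translation {G : Type*} [Group G] [TopologicalSpace G]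
    [IsTopologicalGroup G] [LocallyCompactSpace G] (φ : G →* ∀ i, (T i).Aff (ω i))
    (hc : IsCompact {g : G | ∀ l, φ g l • (H l).spine 0 = (H l).spine 0})
    (ho : IsOpen {g : G | ∀ l, φ g l • (H l).spine 0 = (H l).spine 0}) (t : G) (n : I → ℤ)
    (ht : ∀ l m, φ t l • (H l).spine m = (H l).spine (m + n l)) (i j : I)
    (hi : ∀ l, l ≠ i → n l ≤ 0) (hj : ∀ l, l ≠ j → 0 ≤ n l)
    (hcard : {z | ∃ g : G, (∀ l, φ g l • (H l).spine 0 = (H l).spine 0) ∧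
        φ g i • (H i).spine (n i) = z}.ncard =
      {z | ∃ g : G, (∀ l, φ g l • (H l).spine (n l) = (H l).spine (n l)) ∧
        φ g j • (H j).spine 0 = z}.ncard) :
    Measure.modularCharacter t = 1 := by
  let U : Subgroup G :=
    { carrier := {g : G | ∀ l, φ g l • (H l).spine 0 = (H l).spine 0}
      one_mem' := fun l => by rw [map_one, Pi.one_apply, one_smul]
      mul_mem' := fun {a b} ha hb l => by rw [map_mul, Pi.mul_apply, mul_smul, hb l, ha l]
      inv_mem' := fun {a} ha l => by rw [map_inv, Pi.inv_apply, inv_smul_eq_iff, ha l] }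
  have hU : ∀ g, g ∈ U ↔ ∀ l, φ g l • (H l).spine 0 = (H l).spine 0 := fun g => Iff.rfl
  have hU' : ∀ g, t⁻¹ * g * t ∈ U ↔ ∀ l, φ g l • (H l).spine (n l) = (H l).spine (n l) := by
    intro g
    rw [hU]
    refine forall_congr' fun l => ?_
    rw [map_mul, map_mul, map_inv, Pi.mul_apply, Pi.mul_apply, Pi.inv_apply, mul_smul, mul_smul,
      inv_smul_eq_iff, ht, zero_add]
  have hle : ∀ (g : G) l (m m' : ℤ), m' ≤ m → φ g l • (H l).spine m = (H l).spine m →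
      φ g l • (H l).spine m' = (H l).spine m' := by
    intro g l m m' hm h
    rw [(H l).smul_spine_of_le h hm, sub_self, add_zero]
  -- Only in tree `i` can `spine (n l)` lie below `spine 0`, and only in tree `j` above it. In all
  -- other trees the fixed vertex forces the other one to be fixed as well.
  refine modularCharacter_eq_one_of_orbits ((Pi.evalMonoidHom _ i).comp φ)
    ((Pi.evalMonoidHom _ j).comp φ) U hc ho t ((H i).spine (n i)) ((H j).spine 0) _ _
    (((H i).finite_orbit_stabilizer ((H i).spine 0) ((H i).spine (n i))).subset ?_)
    (((H j).finite_orbit_stabilizer ((H j).spine (n j)) ((H j).spine 0)).subset ?_) hcard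
    (fun g hg => ⟨g, hg, rfl⟩) (fun z hz => hz) (fun g hg => ⟨g, (hU' g).1 hg, rfl⟩)
    (fun z hz => ?_) (fun g hg => ⟨fun h => (hU' g).2 fun l => ?_, fun h => (hU' g).1 h i⟩)
    (fun g hg => ⟨fun h => (hU g).2 fun l => ?_, fun h => (hU g).1 h j⟩)
  · rintro z ⟨g, hg, rfl⟩
    exact ⟨_, hg i, rfl⟩
  · rintro z ⟨g, hg, rfl⟩
    exact ⟨_, hg j, rfl⟩
  · obtain ⟨g, hg, hz⟩ := hz
    exact ⟨g, (hU' g).2 hg, hz⟩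
  · by_cases hl : l = i
    · subst hl
      exact h
    · exact hle g l 0 _ (hi l hl) (hg l)
  · by_cases hl : l = j
    · subst hl
      exact h
    · exact hle g l _ 0 (hj l hl) ((hU' g).1 hg l)

lemma isCompact_pi_stabilizer (H : ∀ i, HoroCoord (T i) (ω i) (q i)) (x : ∀ i, V i) :
    IsCompact {g : ∀ i, (T i).Aff (ω i) | ∀ l, g l • x l = x l} := by
  have h := isCompact_univ_pi fun i => (H i).isCompact_stabilizer (x i)
  convert h using 1
  ext g
  simp

lemma isOpen_pi_stabilizer [Finite I] (x : ∀ i, V i) :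
    IsOpen {g : ∀ i, (T i).Aff (ω i) | ∀ l, g l • x l = x l} := by
  have h := isOpen_set_pi (s := fun i => {g : (T i).Aff (ω i) | g • x i = x i}) Set.finite_univ
    fun i _ => (isLocallyConstant_smul (x i)).isOpen_fiber (x i)
  convert h using 1
  ext g
  simp

/-- The group of pairs of opposite translations, up to exchanging the labels `0` and `1` on
arbitrary levels. -/
def oppositeFlipSubgroup (i j : I) : Subgroup (∀ l, (T l).Aff (ω l)) where
  carrier := {γ | (∀ l, l ≠ i → l ≠ j → γ l = 1) ∧ γ i ∈ (H i).flipSubgroup ∧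
    γ j ∈ (H j).flipSubgroup ∧ (H i).shift (γ i) + (H j).shift (γ j) = 0}
  one_mem' := ⟨fun _ _ _ => rfl, Subgroup.one_mem _, Subgroup.one_mem _, by
    rw [Pi.one_apply, Pi.one_apply, (H i).shift_one, (H j).shift_one, add_zero]⟩
  mul_mem' := by
    rintro x y ⟨h1, h2, h3, h4⟩ ⟨h1', h2', h3', h4'⟩
    refine ⟨fun l hl hl' => ?_, Subgroup.mul_mem _ h2 h2', Subgroup.mul_mem _ h3 h3', ?_⟩
    · rw [Pi.mul_apply, h1 l hl hl', h1' l hl hl', mul_one]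
    · rw [Pi.mul_apply, Pi.mul_apply, (H i).shift_mul, (H j).shift_mul]
      omega
  inv_mem' := by
    rintro x ⟨h1, h2, h3, h4⟩
    refine ⟨fun l hl hl' => ?_, Subgroup.inv_mem _ h2, Subgroup.inv_mem _ h3, ?_⟩
    · rw [Pi.inv_apply, h1 l hl hl', inv_one]
    · rw [Pi.inv_apply, Pi.inv_apply, (H i).shift_inv, (H j).shift_inv]
      omega

lemma mem_oppositeFlipSubgroup {i j : I} {γ : ∀ l, (T l).Aff (ω l)} :
    γ ∈ oppositeFlipSubgroup H i j ↔ (∀ l, l ≠ i → l ≠ j → γ l = 1) ∧ γ i ∈ (H i).flipSubgroup ∧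
    γ j ∈ (H j).flipSubgroup ∧ (H i).shift (γ i) + (H j).shift (γ j) = 0 := Iff.rfl

lemma isClosed_oppositeFlipSubgroup (i j : I) :
    IsClosed (oppositeFlipSubgroup H i j : Set (∀ l, (T l).Aff (ω l))) := by
  have h1 : IsClosed {γ : ∀ l, (T l).Aff (ω l) | ∀ l, l ≠ i → l ≠ j → γ l = 1} := by
    simp only [Set.ofPred_forall]
    exact isClosed_iInter fun l => isClosed_iInter fun _ => isClosed_iInter fun _ =>
      isClosed_singleton.preimage (continuous_apply l)
  have h2 : ∀ l, IsClosed {γ : ∀ l, (T l).Aff (ω l) | γ l ∈ (H l).flipSubgroup} := fun l =>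
    ((H l).isClosed_labelSubgroup _).preimage (continuous_apply l)
  have h3 : ∀ l, Continuous fun γ : ∀ l, (T l).Aff (ω l) => (H l).shift (γ l) := fun l =>
    (H l).isLocallyConstant_shift.continuous.comp (continuous_apply l)
  exact h1.inter ((h2 i).inter ((h2 j).inter (isClosed_eq ((h3 i).add (h3 j)) continuous_const)))

variable [DecidableEq I]

lemma mulSingle_smul_eq {i : I} {g : (T i).Aff (ω i)} {x : ∀ l, V l} (h : g • x i = x i) (l : I) :
    (Pi.mulSingle i g : ∀ l, (T l).Aff (ω l)) l • x l = x l := by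
  by_cases hl : l = i
  · subst hl
    rw [Pi.mulSingle_eq_same, h]
  · rw [Pi.mulSingle_eq_of_ne hl, one_smul]

/-- The vector of translation lengths of a pair of opposite translations. -/
lemma opposite_smul_spine {i j : I} (hij : i ≠ j) {a b : ℤ} {σ : (T i).Aff (ω i)}
    {τ : (T j).Aff (ω j)} (hσ : ∀ m, σ • (H i).spine m = (H i).spine (m + a))
    (hτ : ∀ m, τ • (H j).spine m = (H j).spine (m + b)) (l : I) (m : ℤ) :
    (Pi.mulSingle i σ * Pi.mulSingle j τ⁻¹ : ∀ l, (T l).Aff (ω l)) l • (H l).spine m =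
      (H l).spine (m + (Pi.single i a - Pi.single j b : I → ℤ) l) := by
  rw [Pi.mul_apply, Pi.sub_apply]
  by_cases hi : l = i
  · subst hi
    rw [Pi.mulSingle_eq_same, Pi.mulSingle_eq_of_ne hij, mul_one, Pi.single_eq_same,
      Pi.single_eq_of_ne hij, sub_zero, hσ]
  · rw [Pi.mulSingle_eq_of_ne hi, one_mul, Pi.single_eq_of_ne hi]
    by_cases hj : l = j
    · subst hj
      rw [Pi.mulSingle_eq_same, Pi.single_eq_same, inv_smul_eq_iff, hτ]
      congr 1
      ring
    · rw [Pi.mulSingle_eq_of_ne hj, Pi.single_eq_of_ne hj, one_smul, sub_zero, add_zero]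

lemma orbit_pi_stabilizer (c : I → ℤ) (i : I) (a : ℕ) :
    {z | ∃ g : ∀ l, (T l).Aff (ω l), (∀ l, g l • (H l).spine (c l) = (H l).spine (c l)) ∧
      g i • (H i).spine (c i + a) = z} = {w | (H i).parent^[a] w = (H i).spine (c i)} := by
  ext z
  constructor
  · rintro ⟨g, hg, rfl⟩
    rw [Set.mem_ofPred_eq, ← (H i).smul_iterate, (H i).iterate_spine, add_sub_cancel_right, hg]
  · intro hz
    obtain ⟨g, hg, hgz⟩ := (H i).exists_smul_spine_eq (c i) a hz
    refine ⟨Pi.mulSingle i g, mulSingle_smul_eq (x := fun l => (H l).spine (c l)) hg, ?_⟩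
    rw [Pi.mulSingle_eq_same, hgz]

/-- Two opposite translations with the same local index generate a closed subgroup that is
unimodular but not uniscalar in the product. -/
theorem opposite_translations [Finite I] {i j : I} (hij : i ≠ j) {a b : ℕ} (ha : 1 ≤ a)
    (hb : 1 ≤ b) (hab : (q i + 2) ^ a = (q j + 2) ^ b) {σ : (T i).Aff (ω i)}
    {τ : (T j).Aff (ω j)} (hσ : ∀ m, σ • (H i).spine m = (H i).spine (m + a))
    (hτ : ∀ m, τ • (H j).spine m = (H j).spine (m + b)) {Γ : Subgroup (∀ l, (T l).Aff (ω l))}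
    (hΓ : Γ = Subgroup.zpowers (Pi.mulSingle i σ * Pi.mulSingle j τ⁻¹)) :
    IsClosed (Γ : Set (∀ l, (T l).Aff (ω l))) ∧
      IsUnimodularOn (Γ : Set (∀ l, (T l).Aff (ω l))) ∧
      ¬ IsUniscalarOn (Γ : Set (∀ l, (T l).Aff (ω l))) := by
  have hlc : ∀ l, LocallyCompactSpace ((T l).Aff (ω l)) := fun l => (H l).locallyCompactSpace_aff
  subst hΓ
  have ht := opposite_smul_spine H hij hσ hτ
  set γ : ∀ l, (T l).Aff (ω l) := Pi.mulSingle i σ * Pi.mulSingle j τ⁻¹ with hγ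
  set n : I → ℤ := Pi.single i (a : ℤ) - Pi.single j (b : ℤ) with hn
  have hni : n i = a := by simp [hn, hij]
  have hnj : n j = -b := by simp [hn, hij.symm]
  have hnl : ∀ l, l ≠ i → l ≠ j → n l = 0 := fun l h h' => by simp [hn, h, h']
  refine ⟨?_, ?_, ?_⟩
  -- The locally constant shift in tree `i` takes the value `k * a` at `γ ^ k`, which vanishes for
  -- `k = 0` only.
  · have hd : DiscreteTopology (Subgroup.zpowers γ) := by
      refine discreteTopology_of_isOpen_singleton_one ?_
      have h1 : IsOpen {x : ∀ l, (T l).Aff (ω l) | (H i).shift (x i) = 0} :=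
        (((H i).isLocallyConstant_shift).comp_continuous (continuous_apply i)).isOpen_fiber 0
      convert h1.preimage (continuous_subtype_val (p := fun x => x ∈ Subgroup.zpowers γ)) using 1
      ext ⟨x, hx⟩
      obtain ⟨k, rfl⟩ := Subgroup.mem_zpowers_iff.1 hx
      have h2 : (H i).shift ((γ ^ k) i) = k * a := by
        rw [Pi.pow_apply, (H i).shift_zpow, (H i).shift_eq_of_smul_spine (ht i), hni]
      rw [Set.mem_singleton_iff, Set.mem_preimage, Set.mem_ofPred_eq, h2, Subtype.ext_iff]
      constructor
      · intro h
        have h3 : γ ^ k = 1 := h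
        rw [h3, Pi.one_apply, (H i).shift_one] at h2
        exact h2.symm
      · intro h
        have h3 : k = 0 := by
          rcases mul_eq_zero.1 h with h | h
          · exact h
          · omega
        simp [h3]
    exact Subgroup.isClosed_of_discrete
  · rw [isUnimodularOn_iff]
    have h1 : Measure.modularCharacter γ = 1 := by
      refine modularCharacter_eq_one_of_translation H (MonoidHom.id _)
        (isCompact_pi_stabilizer H _) (isOpen_pi_stabilizer _) γ n ht i j (fun l hl => ?_)
        (fun l hl => ?_) ?_
      · by_cases h : l = j
        · subst h; omega
        · exact (hnl l hl h).le
      · by_cases h : l = i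
        · subst h; omega
        · exact (hnl l h hl).ge
      · have h2 := orbit_pi_stabilizer H (fun _ => 0) i a
        have h3 := orbit_pi_stabilizer H n j b
        simp only [zero_add] at h2
        rw [hnj, neg_add_cancel] at h3
        rw [hni]
        simp only [MonoidHom.id_apply]
        rw [h2, h3, (H i).ncard_descendants, (H j).ncard_descendants, hab]
    have h2 : Subgroup.zpowers γ ≤ (Measure.modularCharacter (G := ∀ l, (T l).Aff (ω l))).ker := by
      rw [Subgroup.zpowers_le]
      exact h1
    exact fun g hg => h2 hg
  · intro hu
    -- Tree `j` is the one in which `γ` moves towards the end; flips at ever higher levels of it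
    -- tend to `1` but move its spine.
    choose u hu1 hu2 hu3 hu4 using fun M : ℕ => (H j).exists_flip M
    refine (H j).groupScale_ne_one (Pi.evalMonoidHom _ j) (continuous_apply j) γ b hb
      (fun m => ?_) (fun M => Pi.mulSingle j (u M)) ?_ (fun M => ?_) (fun M m hm => ?_)
      (hu γ (Subgroup.mem_zpowers γ))
    · have := ht j m
      rwa [hnj, ← sub_eq_add_neg] at this
    · have h1 : Tendsto u atTop (𝓝 1) := by
        refine tendsto_aff_one fun v => ?_
        filter_upwards [eventually_ge_atTop ((H j).level v).toNat] with M hM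
        exact hu1 M v (by omega)
      have h2 := ((continuous_mulSingle (A := fun l => (T l).Aff (ω l)) j).tendsto 1).comp h1
      rwa [Pi.mulSingle_one] at h2
    · simp only [Pi.evalMonoidHom_apply, Pi.mulSingle_eq_same]
      exact hu1 M _ (by rw [(H j).level_spine]; omega)
    · simp only [Pi.evalMonoidHom_apply, Pi.mulSingle_eq_same]
      exact hu2 M m hm

lemma mulSingle_mem_oppositeFlipSubgroup {i j l : I} (hl : l = i ∨ l = j) (hij : i ≠ j)
    {g : (T l).Aff (ω l)} (hg : g ∈ (H l).flipSubgroup) (hs : (H l).shift g = 0) :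
    Pi.mulSingle l g ∈ oppositeFlipSubgroup H i j := by
  rw [mem_oppositeFlipSubgroup]
  rcases hl with rfl | rfl
  · refine ⟨fun k hk _ => Pi.mulSingle_eq_of_ne hk _, ?_, ?_, ?_⟩
    · rwa [Pi.mulSingle_eq_same]
    · rw [Pi.mulSingle_eq_of_ne hij.symm]
      exact Subgroup.one_mem _
    · rw [Pi.mulSingle_eq_same, Pi.mulSingle_eq_of_ne hij.symm, hs, (H j).shift_one, add_zero]
  · refine ⟨fun k _ hk => Pi.mulSingle_eq_of_ne hk _, ?_, ?_, ?_⟩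
    · rw [Pi.mulSingle_eq_of_ne hij]
      exact Subgroup.one_mem _
    · rwa [Pi.mulSingle_eq_same]
    · rw [Pi.mulSingle_eq_same, Pi.mulSingle_eq_of_ne hij, hs, (H i).shift_one, add_zero]

/-- The next spine vertex has label `0`, and on its level the group can only keep this label or turn
it into `1`. The local index is thus `2` for all degrees, so that no condition relating the two
trees is needed. -/
lemma ncard_orbit_oppositeFlipSubgroup (c : I → ℤ) {i j l : I} (hl : l = i ∨ l = j) (hij : i ≠ j) :
    {z | ∃ g : oppositeFlipSubgroup H i j,
      (∀ l, g.1 l • (H l).spine (c l) = (H l).spine (c l)) ∧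
      g.1 l • (H l).spine (c l + 1) = z}.ncard = 2 := by
  have h : {z | ∃ g : oppositeFlipSubgroup H i j,
      (∀ l, g.1 l • (H l).spine (c l) = (H l).spine (c l)) ∧
      g.1 l • (H l).spine (c l + 1) = z} =
      {(H l).child ((H l).spine (c l)) 0, (H l).child ((H l).spine (c l)) 1} := by
    ext z
    constructor
    · rintro ⟨g, hg, rfl⟩
      have h1 : (H l).parent (g.1 l • (H l).spine (c l + 1)) = (H l).spine (c l) := by
        rw [← (H l).smul_parent, (H l).parent_spine, hg]
      have h2 : g.1 l ∈ (H l).flipSubgroup := by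
        rcases hl with rfl | rfl
        · exact g.2.2.1
        · exact g.2.2.2.1
      obtain ⟨κ, hκ, h3⟩ := h2 (c l + 1)
      have h4 := h3 _ ((H l).level_spine _)
      rw [(H l).label_spine] at h4
      rcases HoroCoord.eq_one_or_eq_swap hκ with rfl | rfl
      · exact Or.inl ((H l).eq_child h1 h4).symm
      · rw [Equiv.swap_apply_left] at h4
        exact Or.inr ((H l).eq_child h1 h4).symm
    · rintro (rfl | rfl)
      · refine ⟨1, fun l => one_smul _ _, ?_⟩
        rw [(H l).eq_child ((H l).parent_spine _) ((H l).label_spine _)]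
        exact one_smul _ _
      · obtain ⟨g, hg1, -, hg3, hg4⟩ := (H l).exists_flip (c l)
        have hg0 := hg1 ((H l).spine (c l)) ((H l).level_spine _).le
        refine ⟨⟨Pi.mulSingle l g, mulSingle_mem_oppositeFlipSubgroup H hl hij
          ((H l).mem_flipSubgroup_of_flip hg4) ((H l).shift_eq_zero hg0)⟩,
          mulSingle_smul_eq (x := fun l => (H l).spine (c l)) hg0, ?_⟩
        simp only [Pi.mulSingle_eq_same]
        refine ((H l).eq_child ?_ hg3).symm
        rw [← (H l).smul_parent, (H l).parent_spine, hg0]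
  rw [h, Set.ncard_pair]
  intro h1
  have h2 := (H l).label_child ((H l).spine (c l)) 0
  rw [h1, (H l).label_child] at h2
  exact one_ne_zero h2

theorem oppositeFlipSubgroup_unimodular_not_uniscalar [Finite I] {i j : I} (hij : i ≠ j) :
    IsUnimodularOn (Set.univ : Set (oppositeFlipSubgroup H i j)) ∧
      ¬ IsUniscalarOn (Set.univ : Set (oppositeFlipSubgroup H i j)) := by
  have hlc : ∀ l, LocallyCompactSpace ((T l).Aff (ω l)) := fun l => (H l).locallyCompactSpace_aff
  have hemb := (isClosed_oppositeFlipSubgroup H i j).isClosedEmbedding_subtypeVal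
  have hlc' : LocallyCompactSpace (oppositeFlipSubgroup H i j) := hemb.locallyCompactSpace
  obtain ⟨σ, hσs, hσl, hσ⟩ := (H i).exists_translation 1
  obtain ⟨τ, hτs, hτl, hτ⟩ := (H j).exists_translation 1
  have ht := opposite_smul_spine H hij hσ hτ
  set γ : ∀ l, (T l).Aff (ω l) := Pi.mulSingle i σ * Pi.mulSingle j τ⁻¹ with hγ
  set n : I → ℤ := Pi.single i (1 : ℤ) - Pi.single j (1 : ℤ) with hn
  have hni : n i = 1 := by simp [hn, hij]
  have hnj : n j = -1 := by simp [hn, hij.symm]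
  have hnl : ∀ l, l ≠ i → l ≠ j → n l = 0 := fun l h h' => by simp [hn, h, h']
  have hγi : γ i = σ := by simp [hγ, hij]
  have hγj : γ j = τ⁻¹ := by simp [hγ, hij.symm]
  have hγmem : γ ∈ oppositeFlipSubgroup H i j := by
    refine ⟨fun l hl hl' => by simp [hγ, hl, hl'], ?_, ?_, ?_⟩
    · rw [hγi]
      exact (H i).mem_flipSubgroup_of_label hσl
    · rw [hγj]
      exact Subgroup.inv_mem _ ((H j).mem_flipSubgroup_of_label hτl)
    · rw [hγi, hγj, (H j).shift_inv, hσs, hτs]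
      rfl
  let t : oppositeFlipSubgroup H i j := ⟨γ, hγmem⟩
  constructor
  · rw [isUnimodularOn_iff]
    have h1 : Measure.modularCharacter t = 1 := by
      refine modularCharacter_eq_one_of_translation H (Subgroup.subtype _)
        (hemb.isCompact_preimage (isCompact_pi_stabilizer H fun l => (H l).spine 0))
        ((isOpen_pi_stabilizer fun l => (H l).spine 0).preimage continuous_subtype_val)
        t n ht i j (fun l hl => ?_) (fun l hl => ?_) ?_
      · by_cases h : l = j
        · subst h; omega
        · exact (hnl l hl h).le
      · by_cases h : l = i
        · subst h; omega
        · exact (hnl l h hl).ge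
      · have h2 := ncard_orbit_oppositeFlipSubgroup H (fun _ => 0) (Or.inl rfl) hij
        have h3 := ncard_orbit_oppositeFlipSubgroup H n (Or.inr rfl) hij
        simp only [zero_add] at h2
        rw [hnj, neg_add_cancel] at h3
        rw [hni]
        exact h2.trans h3.symm
    intro g _
    -- Such an element has square `1`, and in the nonnegative reals only `1` has square `1`. Every
    -- other element becomes one of these after division by a power of `t`.
    have h2 : ∀ x : oppositeFlipSubgroup H i j, (H i).shift (x.1 i) = 0 →
        Measure.modularCharacter x = 1 := by
      rintro ⟨x, hx⟩ h
      obtain ⟨hx1, hx2, hx3, hx4⟩ := (mem_oppositeFlipSubgroup H).1 hx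
      have h3 : (⟨x, hx⟩ : oppositeFlipSubgroup H i j) ^ 2 = 1 := by
        refine Subtype.ext (funext fun l => ?_)
        change (x ^ 2) l = 1
        rw [Pi.pow_apply, pow_two]
        by_cases hi : l = i
        · subst hi
          exact (H l).mul_self_of_mem_flipSubgroup hx2 h
        by_cases hj : l = j
        · subst hj
          exact (H l).mul_self_of_mem_flipSubgroup hx3 (by simp only at h; omega)
        rw [hx1 l hi hj, mul_one]
      have h4 := congrArg Measure.modularCharacter h3
      rw [map_pow, map_one] at h4
      exact (pow_eq_one_iff_of_nonneg zero_le two_ne_zero).1 h4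
    have h3 : t ^ (H i).shift (g.1 i) ∈
        (Measure.modularCharacter (G := oppositeFlipSubgroup H i j)).ker :=
      Subgroup.zpow_mem _ h1 _
    have h4 : g * (t ^ (H i).shift (g.1 i))⁻¹ ∈
        (Measure.modularCharacter (G := oppositeFlipSubgroup H i j)).ker := by
      refine h2 _ ?_
      have h5 : (g * (t ^ (H i).shift (g.1 i))⁻¹).1 i = g.1 i * (σ ^ (H i).shift (g.1 i))⁻¹ := by
        rw [← hγi]
        rfl
      rw [h5, (H i).shift_mul, (H i).shift_inv, (H i).shift_zpow, hσs]
      ring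
    have h5 := Subgroup.mul_mem _ h4 h3
    rw [inv_mul_cancel_right] at h5
    exact h5
  · intro hu
    choose u hu1 hu2 hu3 hu4 using fun M : ℕ => (H j).exists_flip M
    have hu0 : ∀ M, u M • (H j).spine 0 = (H j).spine 0 := fun M =>
      hu1 M _ (by rw [(H j).level_spine]; omega)
    refine (H j).groupScale_ne_one
      ((Pi.evalMonoidHom (fun l => (T l).Aff (ω l)) j).comp (Subgroup.subtype _))
      ((continuous_apply j).comp continuous_subtype_val) t 1 le_rfl
      (fun m => ?_) (fun M => ⟨Pi.mulSingle j (u M), mulSingle_mem_oppositeFlipSubgroup H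
        (Or.inr rfl) hij ((H j).mem_flipSubgroup_of_flip (hu4 M))
        ((H j).shift_eq_zero (hu0 M))⟩) ?_ (fun M => ?_) (fun M m hm => ?_) (hu t trivial)
    · have := ht j m
      rwa [hnj, ← sub_eq_add_neg] at this
    · have h1 : Tendsto u atTop (𝓝 1) := by
        refine tendsto_aff_one fun v => ?_
        filter_upwards [eventually_ge_atTop ((H j).level v).toNat] with M hM
        exact hu1 M v (by omega)
      have h2 := ((continuous_mulSingle (A := fun l => (T l).Aff (ω l)) j).tendsto 1).comp h1
      rw [Pi.mulSingle_one] at h2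
      exact tendsto_subtype_rng.2 h2
    · simpa using hu0 M
    · simpa using hu2 M m hm

end Product

end SimpleGraph

/-! ### The theorem -/

theorem mainTheorem9 {k : ℕ} {V : Fin k → Type*} (T : ∀ i, SimpleGraph (V i))
    [∀ i, (T i).LocallyFinite] (d : Fin k → ℕ) (hd : ∀ i, 3 ≤ d i)
    (hT : ∀ i, (T i).IsTree) (hreg : ∀ i, (T i).IsRegularOfDegree (d i))
    (ω : ∀ i, SimpleGraph.TreeEnd (T i)) :
    -- with its own modular function and its own scale function
    (2 ≤ k → ∃ Γ : Subgroup (∀ i, (T i).Aff (ω i)), IsClosed (Γ : Set (∀ i, (T i).Aff (ω i))) ∧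
      IsUnimodularOn (Set.univ : Set Γ) ∧ ¬ IsUniscalarOn (Set.univ : Set Γ)) ∧
    -- with the modular function and the scale function of the product: opposite translations
    (∀ i, ∀ a : ℕ, 1 ≤ a →
      ∃ σ : (T i).Aff (ω i), SimpleGraph.IsTranslationAwayFrom (ω i) a (σ : T i ≃g T i)) ∧
    (∀ i j, i ≠ j → ∀ a b : ℕ, 1 ≤ a → 1 ≤ b → (d i - 1) ^ a = (d j - 1) ^ b →
      ∀ (σ : (T i).Aff (ω i)) (τ : (T j).Aff (ω j)),
        SimpleGraph.IsTranslationAwayFrom (ω i) a (σ : T i ≃g T i) →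
        SimpleGraph.IsTranslationAwayFrom (ω j) b (τ : T j ≃g T j) →
        ∀ Γ : Subgroup (∀ l, (T l).Aff (ω l)),
          Γ = Subgroup.zpowers (Pi.mulSingle i σ * Pi.mulSingle j τ⁻¹) →
          IsClosed (Γ : Set (∀ l, (T l).Aff (ω l))) ∧
          IsUnimodularOn (Γ : Set (∀ l, (T l).Aff (ω l))) ∧
          ¬ IsUniscalarOn (Γ : Set (∀ l, (T l).Aff (ω l)))) := by
  obtain ⟨q, rfl⟩ : ∃ q : Fin k → ℕ, d = fun i => q i + 3 :=
    ⟨fun i => d i - 3, funext fun i => (Nat.sub_add_cancel (hd i)).symm⟩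
  have hne : ∀ i, Nonempty (SimpleGraph.HoroCoord (T i) (ω i) (q i)) := fun i =>
    SimpleGraph.nonempty_horoCoord (hT i) (hreg i) (ω i)
  refine ⟨fun hk => ?_, fun i a _ => ?_, ?_⟩
  · let H := fun i => (hne i).some
    have hij : (⟨0, by omega⟩ : Fin k) ≠ ⟨1, by omega⟩ := by simp
    exact ⟨SimpleGraph.oppositeFlipSubgroup H _ _, SimpleGraph.isClosed_oppositeFlipSubgroup H _ _,
      SimpleGraph.oppositeFlipSubgroup_unimodular_not_uniscalar H hij⟩
  · obtain ⟨g, -, -, hg⟩ := (hne i).some.exists_translation a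
    exact ⟨g, (hne i).some.isTranslationAwayFrom hg⟩
  · intro i j hij a b ha hb hab σ τ hσ hτ Γ hΓ
    obtain ⟨ℓ, h1, h2, h3, h4⟩ := hσ
    obtain ⟨ℓ', h1', h2', h3', h4'⟩ := hτ
    obtain ⟨Hi, hHi⟩ := SimpleGraph.exists_horoCoord_of_line (hT i) (hreg i) h1 h2 h3
    obtain ⟨Hj, hHj⟩ := SimpleGraph.exists_horoCoord_of_line (hT j) (hreg j) h1' h2' h3'
    -- In trees `i` and `j` the spines must be the given translation axes; elsewhere any coordinates
    -- do.
    let H : ∀ l, SimpleGraph.HoroCoord (T l) (ω l) (q l) :=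
      Function.update (Function.update (fun l => (hne l).some) i Hi) j Hj
    have hH1 : H i = Hi := by simp [H, Function.update_of_ne hij]
    have hH2 : H j = Hj := by simp [H]
    refine SimpleGraph.opposite_translations H hij ha hb hab (σ := σ) (τ := τ) ?_ ?_ hΓ
    · rw [hH1, hHi]
      exact h4
    · rw [hH2, hHj]
      exact h4'
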